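/- Let $E=(E^0,E^1,r,s)$ be an arbitrary directed graph and let $R$ be a commutative ring with unit. Paths, trails. Vertices are paths of length $0$; $\mathrm{Path}(E)$ is the set of all finite paths and $l(\alpha)$ is the length of $\alpha$. A vertex is a sink if it emits no edges, and regular if it emits a finite nonzero number of edges. An exit of a path $e_1\cdots e_n$ is an edge $e$ with $s(e)=s(e_i)$ and $e\ne e_i$ for some $i$. A trail is either a finite path (possibly of length $0$) ending in a sink, or an infinite path $e_1e_2\cdots$ with $r(e_n)=s(e_{n+1})$ for all $n$. An infinite trail is periodic if there are $j,k\ge 1$ with $e_{n+k}=e_n$ for all $n\ge j$; for the choice of such $(j,k)$ with $j+k$ minimal, the closed path $e_j\cdots e_{j+k-1}$ is its period. A trail is essentially aperiodic if it is finite, or if it is periodic and its period has no exits, or if it is infinite and not periodic. Let $\mathfrak T_E$ be the set of essentially aperiodic trails; if $\tau\in\mathfrak T_E$ and $r(\alpha)=s(\tau)$ then $\alpha\tau\in\mathfrak T_E$. Leavitt path algebra. $L_R(E)$ is the universal (not necessarily unital) $R$-algebra generated by pairwise orthogonal idempotents $v$ ($v\in E^0$) and elements $e,e^*$ ($e\in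 E^1$) such that $s(e)e=e=er(e)$, $r(e)e^*=e^*=e^*s(e)$, $e^*e=r(e)$, $e^*f=0$ for edges $e\neq f$, and $v=\sum_{s(e)=v}ee^*$ for every regular vertex $v$. Its involution is the $R$-linear one with $v^*=v$ that interchanges $e$ and $e^*$. A Cuntz–Krieger $E$-system in an $R$-algebra $\mathcal A$ with $R$-linear involution $*$ is a family $(S_\mu)_{\mu\in E^0\cup E^1}$ in $\mathcal A$ such that the $S_v$ ($v\in E^0$) are pairwise orthogonal self-adjoint idempotents, $S_{s(e)}S_e=S_e=S_eS_{r(e)}$, $S_e^*S_e=S_{r(e)}$, $S_e^*S_f=0$ for $e\ne f$, and $S_v=\sum_{s(e)=v}S_eS_e^*$ for every regular $v$. It is extended to paths by $S_{e_1\cdots e_n}=S_{e_1}\cdots S_{e_n}$. Proposition. Let $M$ be the free $R$-module with basis $\{\xi_\tau^n : n\in\mathbb Z,\ \tau\in\mathfrak T_E\}$, and let $M_i$ be the submodule generated by the $\xi^i_\tau$ with $\tau\in\mathfrak T_E$. For $k\in\mathbb Z$ let $\mathcal E_k$ be the set of all $f\in\mathrm{End}_R(M)$ such that $f(M_i)\subseteq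 M_{i+k}$ for all $i$ and such that the transpose of the matrix of $f$ in the basis $(\xi_\tau^n)$ is again the matrix of an endomorphism of $M$. Then $\mathcal E=\bigoplus_{k\in\mathbb Z}\mathcal E_k$ is a $\mathbb Z$-graded $R$-subalgebra of $\mathrm{End}_R(M)$, transposition is an $R$-linear involution $*$ of $\mathcal E$, and there is a unique Cuntz–Krieger $E$-system in $\mathcal E$ whose extension $(S_\alpha)_{\alpha\in\mathrm{Path}(E)}$ satisfies $$S_\alpha(\xi_\tau^n)=\begin{cases}\xi_{\alpha\tau}^{\,n+l(\alpha)} & \text{if } r(\alpha)=s(\tau),\\ 0 & \text{otherwise,}\end{cases}$$ for all $\alpha\in\mathrm{Path}(E)$, $\tau\in\mathfrak T_E$ and $n\in\mathbb Z$. Moreover $S_\alpha\in\mathcal E_{l(\alpha)}$ for all $\alpha$. There is a unique $*$-homomorphism $\Pi_{\mathrm{ap}}:L_R(E)\to\mathcal E$ of $R$-algebras with $\Pi_{\mathrm{ap}}(v)=S_v$, $\Pi_{\mathrm{ap}}(e)=S_e$ and $\Pi_{\mathrm{ap}}(e^*)=S_e^*$ for all $v\in E^0$, $e\in E^1$, and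 $\Pi_{\mathrm{ap}}$ is injective. -/

import Mathlib

universe u v w

namespace LPA

noncomputable section

/-! ### Graphs, paths, trails -/

/-- A directed graph `(E⁰, E¹, r, s)`: arbitrary sets of vertices and of edges. -/
structure Graph where
  Vert : Type v
  Edge : Type w
  src : Edge → Vert
  rng : Edge → Vert

namespace Graph

variable (E : Graph.{v, w})

/-- The vertex `x` emits no edge. -/
def IsSink (x : E.Vert) : Prop := {e : E.Edge | E.src e = x} = ∅

/-- The vertex `x` emits at least one and at most finitely many edges. -/
def IsRegular (x : E.Vert) : Prop :=
  {e : E.Edge | E.src e = x}.Finite ∧ {e : E.Edge | E.src e = x}.Nonempty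

/-- The list `e₁, …, eₙ` is a path starting at the vertex `x`
(`s(e₁) = x`, and `r(eᵢ) = s(eᵢ₊₁)`); the empty list is the path of length `0` at `x`. -/
def IsWalk : E.Vert → List E.Edge → Prop
  | _, [] => True
  | x, e :: l => E.src e = x ∧ IsWalk (E.rng e) l

/-- The last vertex of the walk `l` that starts at the given vertex. -/
def walkEnd : E.Vert → List E.Edge → E.Vert
  | x, [] => x
  | _, e :: l => walkEnd (E.rng e) l

/-- A finite path. It records its source, so that the paths of length `0` are the vertices. -/
@[ext]
structure Path where
  source : E.Vert
  edges : List E.Edge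
  isWalk : E.IsWalk source edges

variable {E}

/-- The range `r(α)` of a path. -/
def Path.range (α : E.Path) : E.Vert := E.walkEnd α.source α.edges

/-- The length `l(α)` of a path. -/
def Path.length (α : E.Path) : ℕ := α.edges.length

theorem isWalk_append {x : E.Vert} {l m : List E.Edge} (hl : E.IsWalk x l)
    (hm : E.IsWalk (E.walkEnd x l) m) : E.IsWalk x (l ++ m) := by
  induction l generalizing x with
  | nil => exact hm
  | cons e l ih => exact ⟨hl.1, ih hl.2 hm⟩

theorem walkEnd_append (x : E.Vert) (l m : List E.Edge) :
    E.walkEnd x (l ++ m) = E.walkEnd (E.walkEnd x l) m := by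
  induction l generalizing x with
  | nil => rfl
  | cons e l ih => exact ih _

/-- Concatenation `αβ` of two paths with `r(α) = s(β)`. -/
def Path.append (α β : E.Path) (h : α.range = β.source) : E.Path where
  source := α.source
  edges := α.edges ++ β.edges
  isWalk := isWalk_append α.isWalk (by
    have := β.isWalk
    rw [← h] at this
    exact this)

theorem Path.range_append (α β : E.Path) (h : α.range = β.source) :
    (α.append β h).range = β.range := by
  change E.walkEnd α.source (α.edges ++ β.edges) = E.walkEnd β.source β.edges
  rw [walkEnd_append, ← h]
  rfl

/-- The sequence `f 0, f 1, f 2, …` of edges is an infinite path. -/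
def IsInfinitePath (f : ℕ → E.Edge) : Prop := ∀ n, E.rng (f n) = E.src (f (n + 1))

variable (E) in
/-- A trail: a finite path (possibly of length `0`) that ends in a sink, or an infinite path. -/
inductive Trail where
  | finite (α : E.Path) (h : E.IsSink α.range) : Trail
  | infinite (f : ℕ → E.Edge) (h : IsInfinitePath f) : Trail

/-- The source `s(τ)` of a trail. -/
def Trail.source : E.Trail → E.Vert
  | .finite α _ => α.source
  | .infinite f _ => E.src (f 0)

/-- The sequence `a₁, …, aₖ, f 0, f 1, …`, for a list `l = [a₁, …, aₖ]`. -/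
def prepend {A : Type w} : List A → (ℕ → A) → ℕ → A
  | [], f => f
  | a :: l, f => fun n => Nat.casesOn n a (prepend l f)

theorem prepend_isInfinitePath {x : E.Vert} {l : List E.Edge} {f : ℕ → E.Edge}
    (hl : E.IsWalk x l) (hf : IsInfinitePath f) (h : E.walkEnd x l = E.src (f 0)) :
    IsInfinitePath (prepend l f) ∧ E.src (prepend l f 0) = x := by
  induction l generalizing x with
  | nil => exact ⟨hf, h.symm⟩
  | cons e l ih =>
    obtain ⟨h1, h2⟩ := ih hl.2 h
    refine ⟨fun n => ?_, hl.1⟩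
    cases n with
    | zero => exact h2.symm
    | succ n => exact h1 n

/-- Concatenation `ατ` of a path and a trail with `r(α) = s(τ)`. -/
def Path.concat (α : E.Path) : (τ : E.Trail) → α.range = τ.source → E.Trail
  | .finite β hβ, h => .finite (α.append β h) ((Path.range_append α β h).symm ▸ hβ)
  | .infinite f hf, h => .infinite (prepend α.edges f)
      (prepend_isInfinitePath α.isWalk hf h).1

/-- `e_{n+k} = e_n` for all `n ≥ j`, where `k ≥ 1` (the sequence is indexed from `0`). -/
def RepeatsFrom (f : ℕ → E.Edge) (j k : ℕ) : Prop := 1 ≤ k ∧ ∀ n, j ≤ n → f (n + k) = f n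

/-- The infinite path `f` is periodic. -/
def IsPeriodic (f : ℕ → E.Edge) : Prop := ∃ j k, RepeatsFrom f j k

/-- `j + k` is smallest possible among the pairs with `RepeatsFrom f j k`; the seed of `f` is then
the pair `(e_0 ⋯ e_{j-1}, e_j ⋯ e_{j+k-1})`. -/
def IsSeed (f : ℕ → E.Edge) (j k : ℕ) : Prop :=
  RepeatsFrom f j k ∧ ∀ j' k', RepeatsFrom f j' k' → j + k ≤ j' + k'

/-- The edges of the path `e_j ⋯ e_{j+k-1}`. -/
def segment (f : ℕ → E.Edge) (j k : ℕ) : List E.Edge := (List.range k).map fun i => f (j + i)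

/-- The path with edges `l` has an exit: an edge with the same source as some edge
of the path but different from that edge. -/
def HasExit (l : List E.Edge) : Prop := ∃ a ∈ l, ∃ e, E.src e = E.src a ∧ e ≠ a

/-- Essentially aperiodic trails: the finite trails, the periodic infinite trails whose period is a
closed path without exits, and the infinite trails that are not periodic. -/
def Trail.IsEssAperiodic : E.Trail → Prop
  | .finite _ _ => True
  | .infinite f _ =>
      (∃ j k, IsSeed f j k ∧ ¬ HasExit (segment f j k)) ∨ ¬ IsPeriodic f

variable (E) in
/-- The set `𝔗_E` of essentially aperiodic trails. -/
abbrev EssAperiodicTrail : Type (max v w) := {τ : E.Trail // τ.IsEssAperiodic}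

theorem exists_seed {f : ℕ → E.Edge} (h : IsPeriodic f) : ∃ j k, IsSeed f j k := by
  classical
  have hex : ∃ N, ∃ j k, RepeatsFrom f j k ∧ j + k = N := by
    obtain ⟨j, k, hjk⟩ := h
    exact ⟨_, j, k, hjk, rfl⟩
  obtain ⟨j, k, hjk, hN⟩ := Nat.find_spec hex
  exact ⟨j, k, hjk, fun j' k' h' => hN ▸ Nat.find_min' hex ⟨j', k', h', rfl⟩⟩

theorem repeatsFrom_mul {f : ℕ → E.Edge} {j k : ℕ} (h : RepeatsFrom f j k) (m : ℕ) :
    ∀ n, j ≤ n → f (n + m * k) = f n := by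
  induction m with
  | zero => simp
  | succ m ih =>
    intro n hn
    have h1 := h.2 (n + m * k) (by omega)
    rw [ih n hn] at h1
    rw [← h1]
    congr 1
    ring

theorem not_hasExit_segment {f : ℕ → E.Edge} {j k : ℕ} (h : RepeatsFrom f j k) :
    ¬ HasExit (segment f j k) ↔
      ∃ N, ∀ n, N ≤ n → ∀ e, E.src e = E.src (f n) → e = f n := by
  constructor
  · intro hx
    refine ⟨j, fun n hn e he => ?_⟩
    by_contra hne
    refine hx ⟨f n, ?_, e, he, hne⟩
    refine List.mem_map.2 ⟨(n - j) % k, List.mem_range.2 (Nat.mod_lt _ h.1), ?_⟩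
    have h1 := repeatsFrom_mul h ((n - j) / k) (j + (n - j) % k) (by omega)
    rw [← h1]
    congr 1
    have := Nat.mod_add_div' (n - j) k
    omega
  · rintro ⟨N, hN⟩ ⟨a, ha, e, he, hne⟩
    obtain ⟨i, -, rfl⟩ := List.mem_map.1 ha
    have h1 := repeatsFrom_mul h N (j + i) (by omega)
    have hk := h.1
    have h2 : N ≤ j + i + N * k := by nlinarith
    exact hne (by rw [← h1] at he ⊢; exact hN _ h2 e he)

theorem isEssAperiodic_infinite {f : ℕ → E.Edge} (hf : IsInfinitePath f) :
    (Trail.infinite f hf).IsEssAperiodic ↔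
      (IsPeriodic f → ∃ N, ∀ n, N ≤ n → ∀ e, E.src e = E.src (f n) → e = f n) := by
  constructor
  · rintro (⟨j, k, hs, hx⟩ | h) hp
    · exact (not_hasExit_segment hs.1).1 hx
    · exact absurd hp h
  · intro h
    by_cases hp : IsPeriodic f
    · obtain ⟨j, k, hs⟩ := exists_seed hp
      exact Or.inl ⟨j, k, hs, (not_hasExit_segment hs.1).2 (h hp)⟩
    · exact Or.inr hp

theorem prepend_add {A : Type w} (l : List A) (f : ℕ → A) (n : ℕ) :
    prepend l f (n + l.length) = f n := by
  induction l with
  | nil => rfl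
  | cons a l ih => exact ih

/-- The concatenation `ατ` is essentially aperiodic when `τ` is. -/
theorem concat_isEssAperiodic (α : E.Path) (τ : E.Trail) (h : α.range = τ.source)
    (hτ : τ.IsEssAperiodic) : (α.concat τ h).IsEssAperiodic := by
  cases τ with
  | finite β hβ => trivial
  | infinite f hf =>
    refine (isEssAperiodic_infinite _).2 ?_
    rintro ⟨j, k, hk, hjk⟩
    have hp : IsPeriodic f := by
      refine ⟨j, k, hk, fun n hn => ?_⟩
      have h1 := hjk (n + α.edges.length) (by omega)
      rw [show n + α.edges.length + k = n + k + α.edges.length by omega] at h1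
      rwa [prepend_add, prepend_add] at h1
    obtain ⟨N, hN⟩ := (isEssAperiodic_infinite hf).1 hτ hp
    refine ⟨N + α.edges.length, fun n hn => ?_⟩
    obtain ⟨m, rfl⟩ : ∃ m, n = m + α.edges.length := ⟨n - α.edges.length, by omega⟩
    rw [prepend_add]
    exact hN m (by omega)

/-- Concatenation `ατ ∈ 𝔗_E` of a path with some `τ ∈ 𝔗_E` such that `r(α) = s(τ)`. -/
def EssAperiodicTrail.concat (α : E.Path) (τ : E.EssAperiodicTrail)
    (h : α.range = τ.1.source) : E.EssAperiodicTrail :=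
  ⟨α.concat τ.1 h, concat_isEssAperiodic α τ.1 h τ.2⟩

end Graph

/-! ### The Leavitt path algebra -/

/-- The free generators: `v` for each vertex, `e` and the ghost edge `e*` for each edge. -/
inductive Gen (E : Graph.{v, w}) where
  | vert (x : E.Vert) : Gen E
  | edge (e : E.Edge) : Gen E
  | ghost (e : E.Edge) : Gen E

/-- The three families `v`, `e`, `e*` of elements of a ring satisfy the defining relations of the
Leavitt path algebra. -/
structure LeavittRelations (E : Graph.{v, w}) {A : Type*} [NonUnitalRing A]
    (g : Gen E → A) : Prop where
  vert_mul_self : ∀ x, g (.vert x) * g (.vert x) = g (.vert x)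
  vert_mul_ne : ∀ x y, x ≠ y → g (.vert x) * g (.vert y) = 0
  src_mul_edge : ∀ e, g (.vert (E.src e)) * g (.edge e) = g (.edge e)
  edge_mul_rng : ∀ e, g (.edge e) * g (.vert (E.rng e)) = g (.edge e)
  rng_mul_ghost : ∀ e, g (.vert (E.rng e)) * g (.ghost e) = g (.ghost e)
  ghost_mul_src : ∀ e, g (.ghost e) * g (.vert (E.src e)) = g (.ghost e)
  ghost_mul_edge : ∀ e, g (.ghost e) * g (.edge e) = g (.vert (E.rng e))
  ghost_mul_edge_ne : ∀ e f, e ≠ f → g (.ghost e) * g (.edge f) = 0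
  vert_eq_sum : ∀ x (h : E.IsRegular x),
    g (.vert x) = ∑ e ∈ h.1.toFinset, g (.edge e) * g (.ghost e)

section Leavitt

variable (R : Type u) [CommRing R] (E : Graph.{v, w})

open FreeAlgebra (ι)

/-- The defining relations, imposed on the free unital algebra. -/
inductive Rel : FreeAlgebra R (Gen E) → FreeAlgebra R (Gen E) → Prop
  | vert_mul_self (x) : Rel (ι R (.vert x) * ι R (.vert x)) (ι R (.vert x))
  | vert_mul_ne (x y) (h : x ≠ y) : Rel (ι R (.vert x) * ι R (.vert y)) 0
  | src_mul_edge (e) : Rel (ι R (.vert (E.src e)) * ι R (.edge e)) (ι R (.edge e))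
  | edge_mul_rng (e) : Rel (ι R (.edge e) * ι R (.vert (E.rng e))) (ι R (.edge e))
  | rng_mul_ghost (e) : Rel (ι R (.vert (E.rng e)) * ι R (.ghost e)) (ι R (.ghost e))
  | ghost_mul_src (e) : Rel (ι R (.ghost e) * ι R (.vert (E.src e))) (ι R (.ghost e))
  | ghost_mul_edge (e) : Rel (ι R (.ghost e) * ι R (.edge e)) (ι R (.vert (E.rng e)))
  | ghost_mul_edge_ne (e f) (h : e ≠ f) : Rel (ι R (.ghost e) * ι R (.edge f)) 0
  | vert_eq_sum (x) (h : E.IsRegular x) :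
      Rel (ι R (.vert x)) (∑ e ∈ h.1.toFinset, ι R (.edge e) * ι R (.ghost e))

/-- The unital algebra presented by the generators and relations. -/
abbrev UnitalLeavitt : Type _ := RingQuot (Rel R E)

/-- The generators in the unital algebra. -/
def unitalGen (g : Gen E) : UnitalLeavitt R E := RingQuot.mkAlgHom R (Rel R E) (ι R g)

theorem unitalGen_relations : LeavittRelations E (unitalGen R E) where
  vert_mul_self x := by
    simpa [unitalGen] using RingQuot.mkAlgHom_rel R (Rel.vert_mul_self (R := R) (E := E) x)
  vert_mul_ne x y h := by
    simpa [unitalGen] using RingQuot.mkAlgHom_rel R (Rel.vert_mul_ne (R := R) (E := E) x y h)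
  src_mul_edge e := by
    simpa [unitalGen] using RingQuot.mkAlgHom_rel R (Rel.src_mul_edge (R := R) (E := E) e)
  edge_mul_rng e := by
    simpa [unitalGen] using RingQuot.mkAlgHom_rel R (Rel.edge_mul_rng (R := R) (E := E) e)
  rng_mul_ghost e := by
    simpa [unitalGen] using RingQuot.mkAlgHom_rel R (Rel.rng_mul_ghost (R := R) (E := E) e)
  ghost_mul_src e := by
    simpa [unitalGen] using RingQuot.mkAlgHom_rel R (Rel.ghost_mul_src (R := R) (E := E) e)
  ghost_mul_edge e := by
    simpa [unitalGen] using RingQuot.mkAlgHom_rel R (Rel.ghost_mul_edge (R := R) (E := E) e)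
  ghost_mul_edge_ne e f h := by
    simpa [unitalGen] using
      RingQuot.mkAlgHom_rel R (Rel.ghost_mul_edge_ne (R := R) (E := E) e f h)
  vert_eq_sum x h := by
    simpa [unitalGen] using RingQuot.mkAlgHom_rel R (Rel.vert_eq_sum (R := R) (E := E) x h)

variable {R E} in
/-- Universal property of the unital algebra. -/
def unitalLift {A : Type*} [Ring A] [Algebra R A] (g : Gen E → A) (hg : LeavittRelations E g) :
    UnitalLeavitt R E →ₐ[R] A :=
  RingQuot.liftAlgHom R ⟨FreeAlgebra.lift R g, by
    intro a b h
    cases h with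
    | vert_mul_self x => simpa using hg.vert_mul_self x
    | vert_mul_ne x y h => simpa using hg.vert_mul_ne x y h
    | src_mul_edge e => simpa using hg.src_mul_edge e
    | edge_mul_rng e => simpa using hg.edge_mul_rng e
    | rng_mul_ghost e => simpa using hg.rng_mul_ghost e
    | ghost_mul_src e => simpa using hg.ghost_mul_src e
    | ghost_mul_edge e => simpa using hg.ghost_mul_edge e
    | ghost_mul_edge_ne e f h => simpa using hg.ghost_mul_edge_ne e f h
    | vert_eq_sum x h => simpa using hg.vert_eq_sum x h⟩

variable {R E} in
theorem unitalLift_gen {A : Type*} [Ring A] [Algebra R A] (g : Gen E → A)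
    (hg : LeavittRelations E g) (a : Gen E) : unitalLift (R := R) g hg (unitalGen R E a) = g a := by
  simp [unitalLift, unitalGen]

variable {R E} in
theorem unitalHom_ext {A : Type*} [Ring A] [Algebra R A] {φ ψ : UnitalLeavitt R E →ₐ[R] A}
    (h : ∀ a, φ (unitalGen R E a) = ψ (unitalGen R E a)) : φ = ψ := by
  apply RingQuot.ringQuot_ext'
  apply FreeAlgebra.hom_ext
  funext a
  exact h a

/-- The Leavitt path algebra `L_R(E)`, an algebra that need not have a unit: the non-unital
subalgebra generated by all `v`, `e`, `e*` inside the unital algebra with the same generators and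
relations. It has the universal property in the class of all, not necessarily unital, algebras: see
`exists_unique_lift` below. -/
abbrev LeavittPathAlgebra : Type _ := NonUnitalAlgebra.adjoin R (Set.range (unitalGen R E))

/-- The generators `v`, `e`, `e*` of `L_R(E)`. -/
def gen (a : Gen E) : LeavittPathAlgebra R E :=
  ⟨unitalGen R E a, NonUnitalAlgebra.subset_adjoin R ⟨a, rfl⟩⟩

theorem gen_relations : LeavittRelations E (gen R E) where
  vert_mul_self x := Subtype.ext ((unitalGen_relations R E).vert_mul_self x)
  vert_mul_ne x y h := Subtype.ext ((unitalGen_relations R E).vert_mul_ne x y h)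
  src_mul_edge e := Subtype.ext ((unitalGen_relations R E).src_mul_edge e)
  edge_mul_rng e := Subtype.ext ((unitalGen_relations R E).edge_mul_rng e)
  rng_mul_ghost e := Subtype.ext ((unitalGen_relations R E).rng_mul_ghost e)
  ghost_mul_src e := Subtype.ext ((unitalGen_relations R E).ghost_mul_src e)
  ghost_mul_edge e := Subtype.ext ((unitalGen_relations R E).ghost_mul_edge e)
  ghost_mul_edge_ne e f h := Subtype.ext ((unitalGen_relations R E).ghost_mul_edge_ne e f h)
  vert_eq_sum x h := Subtype.ext (by
    rw [AddSubmonoidClass.coe_finsetSum]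
    exact (unitalGen_relations R E).vert_eq_sum x h)

/-- `L_R(E)` is the universal algebra, unital or not, with generators `v`, `e`, `e*` subject to the
relations. -/
theorem exists_unique_lift {A : Type*} [NonUnitalRing A] [Module R A] [IsScalarTower R A A]
    [SMulCommClass R A A] (g : Gen E → A) (hg : LeavittRelations E g) :
    ∃! φ : LeavittPathAlgebra R E →ₙₐ[R] A, ∀ a, φ (gen R E a) = g a := by
  let j : A →ₙₐ[R] Unitization R A := Unitization.inrNonUnitalAlgHom R A
  have hj : Function.Injective j := Unitization.inr_injective
  have hg' : LeavittRelations E fun a => j (g a) :=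
    { vert_mul_self := fun x => by rw [← map_mul, hg.vert_mul_self]
      vert_mul_ne := fun x y h => by rw [← map_mul, hg.vert_mul_ne x y h, map_zero]
      src_mul_edge := fun e => by rw [← map_mul, hg.src_mul_edge]
      edge_mul_rng := fun e => by rw [← map_mul, hg.edge_mul_rng]
      rng_mul_ghost := fun e => by rw [← map_mul, hg.rng_mul_ghost]
      ghost_mul_src := fun e => by rw [← map_mul, hg.ghost_mul_src]
      ghost_mul_edge := fun e => by rw [← map_mul, hg.ghost_mul_edge]
      ghost_mul_edge_ne := fun e f h => by rw [← map_mul, hg.ghost_mul_edge_ne e f h, map_zero]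
      vert_eq_sum := fun x h => by simp only [hg.vert_eq_sum x h, map_sum, map_mul] }
  let Φ : UnitalLeavitt R E →ₐ[R] Unitization R A := unitalLift _ hg'
  have hΦ : ∀ a, Φ (unitalGen R E a) = j (g a) := unitalLift_gen _ hg'
  have hmem : ∀ x : LeavittPathAlgebra R E, ∃ a, j a = Φ x.1 := by
    rintro ⟨x, hx⟩
    induction hx using NonUnitalAlgebra.adjoin_induction with
    | mem x hx => obtain ⟨a, rfl⟩ := hx; exact ⟨g a, (hΦ a).symm⟩
    | add x y _ _ hx hy =>
      obtain ⟨a, ha⟩ := hx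
      obtain ⟨b, hb⟩ := hy
      exact ⟨a + b, by simp only [map_add, ha, hb]⟩
    | zero => exact ⟨0, by simp only [map_zero]⟩
    | mul x y _ _ hx hy =>
      obtain ⟨a, ha⟩ := hx
      obtain ⟨b, hb⟩ := hy
      exact ⟨a * b, by simp only [map_mul, ha, hb]⟩
    | smul r x _ hx =>
      obtain ⟨a, ha⟩ := hx
      exact ⟨r • a, by simp only [map_smul, ha]⟩
  choose F hF using hmem
  refine ⟨{ toFun := F, map_smul' := fun r x => hj ?_, map_zero' := hj ?_,
            map_add' := fun x y => hj ?_, map_mul' := fun x y => hj ?_ }, fun a => hj ?_, ?_⟩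
  · simp [hF]
  · simp [hF]
  · simp [hF]
  · simp [hF]
  · exact (hF _).trans (hΦ a)
  · intro ψ hψ
    refine NonUnitalAlgHom.ext ?_
    rintro ⟨x, hx⟩
    apply hj
    refine Eq.trans ?_ (hF ⟨x, hx⟩).symm
    induction hx using NonUnitalAlgebra.adjoin_induction with
    | mem x hx =>
      obtain ⟨a, rfl⟩ := hx
      exact (congrArg j (hψ a)).trans (hΦ a).symm
    | add x y hx' hy' hx hy =>
      have h : (⟨x + y, add_mem hx' hy'⟩ : LeavittPathAlgebra R E) = ⟨x, hx'⟩ + ⟨y, hy'⟩ := rfl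
      rw [h, map_add, map_add, hx, hy]
      exact (map_add Φ x y).symm
    | zero =>
      have h : (⟨0, zero_mem _⟩ : LeavittPathAlgebra R E) = 0 := rfl
      rw [h, map_zero, map_zero]
      exact (map_zero Φ).symm
    | mul x y hx' hy' hx hy =>
      have h : (⟨x * y, mul_mem hx' hy'⟩ : LeavittPathAlgebra R E) = ⟨x, hx'⟩ * ⟨y, hy'⟩ := rfl
      rw [h, map_mul, map_mul, hx, hy]
      exact (map_mul Φ x y).symm
    | smul r x hx' hx =>
      have h : (⟨r • x, SMulMemClass.smul_mem r hx'⟩ : LeavittPathAlgebra R E) = r • ⟨x, hx'⟩ :=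
        rfl
      rw [h, map_smul, map_smul, hx]
      exact (map_smul Φ r x).symm

/-- `v ↦ v`, `e ↦ e*`, `e* ↦ e`. -/
def Gen.swap {E : Graph.{v, w}} : Gen E → Gen E
  | .vert x => .vert x
  | .edge e => .ghost e
  | .ghost e => .edge e

open MulOpposite in
/-- The homomorphism to the opposite algebra with `v ↦ v`, `e ↦ e*`, `e* ↦ e`. -/
def starHom : UnitalLeavitt R E →ₐ[R] (UnitalLeavitt R E)ᵐᵒᵖ :=
  unitalLift (fun a => op (unitalGen R E a.swap))
    (have h := unitalGen_relations R E
    { vert_mul_self := fun x => congrArg op (h.vert_mul_self x)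
      vert_mul_ne := fun x y hxy => congrArg op (h.vert_mul_ne y x hxy.symm)
      src_mul_edge := fun e => congrArg op (h.ghost_mul_src e)
      edge_mul_rng := fun e => congrArg op (h.rng_mul_ghost e)
      rng_mul_ghost := fun e => congrArg op (h.edge_mul_rng e)
      ghost_mul_src := fun e => congrArg op (h.src_mul_edge e)
      ghost_mul_edge := fun e => congrArg op (h.ghost_mul_edge e)
      ghost_mul_edge_ne := fun e f hef => congrArg op (h.ghost_mul_edge_ne f e hef.symm)
      vert_eq_sum := fun x hx => by
        refine (congrArg op (h.vert_eq_sum x hx)).trans ?_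
        rw [Finset.op_sum]
        rfl })

theorem starHom_gen (a : Gen E) :
    starHom R E (unitalGen R E a) = MulOpposite.op (unitalGen R E a.swap) :=
  unitalLift_gen _ _ a

theorem starHom_starHom (x : UnitalLeavitt R E) :
    (starHom R E (starHom R E x).unop).unop = x := by
  have h : (AlgHom.opComm (starHom R E)).comp (starHom R E) = AlgHom.id R _ :=
    unitalHom_ext fun a => by
      change (starHom R E (starHom R E (unitalGen R E a)).unop).unop = unitalGen R E a
      rw [starHom_gen, MulOpposite.unop_op, starHom_gen, MulOpposite.unop_op]
      cases a <;> rfl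
  exact DFunLike.congr_fun h x

theorem starHom_mem {x : UnitalLeavitt R E}
    (hx : x ∈ NonUnitalAlgebra.adjoin R (Set.range (unitalGen R E))) :
    (starHom R E x).unop ∈ NonUnitalAlgebra.adjoin R (Set.range (unitalGen R E)) := by
  induction hx using NonUnitalAlgebra.adjoin_induction with
  | mem x hx =>
    obtain ⟨a, rfl⟩ := hx
    rw [starHom_gen]
    exact NonUnitalAlgebra.subset_adjoin R ⟨a.swap, rfl⟩
  | add x y _ _ hx hy => rw [map_add]; exact add_mem hx hy
  | zero => rw [map_zero]; exact zero_mem _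
  | mul x y _ _ hx hy => rw [map_mul]; exact mul_mem hy hx
  | smul r x _ hx => rw [map_smul]; exact SMulMemClass.smul_mem r hx

/-- The involution of `L_R(E)`: the `R`-linear anti-automorphism with `v* = v` that interchanges
`e` and `e*`. -/
instance leavittStarRing : StarRing (LeavittPathAlgebra R E) where
  star x := ⟨(starHom R E x.1).unop, starHom_mem R E x.2⟩
  star_involutive x := Subtype.ext (starHom_starHom R E x.1)
  star_mul x y := Subtype.ext (by simp)
  star_add x y := Subtype.ext (by simp)

theorem star_gen (a : Gen E) : star (gen R E a) = gen R E a.swap :=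
  Subtype.ext (congrArg MulOpposite.unop (starHom_gen R E a))

end Leavitt

/-! ### Cuntz–Krieger systems -/

/-- A Cuntz–Krieger `E`-system `(S_μ)_{μ ∈ E⁰ ∪ E¹}` in a ring with involution. -/
structure IsCuntzKriegerSystem (E : Graph.{v, w}) {A : Type*} [NonUnitalRing A] [StarRing A]
    (S : E.Vert ⊕ E.Edge → A) : Prop where
  vert_mul_self : ∀ x, S (.inl x) * S (.inl x) = S (.inl x)
  vert_mul_ne : ∀ x y, x ≠ y → S (.inl x) * S (.inl y) = 0
  star_vert : ∀ x, star (S (.inl x)) = S (.inl x)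
  src_mul_edge : ∀ e, S (.inl (E.src e)) * S (.inr e) = S (.inr e)
  edge_mul_rng : ∀ e, S (.inr e) * S (.inl (E.rng e)) = S (.inr e)
  star_mul_edge : ∀ e, star (S (.inr e)) * S (.inr e) = S (.inl (E.rng e))
  star_mul_edge_ne : ∀ e f, e ≠ f → star (S (.inr e)) * S (.inr f) = 0
  vert_eq_sum : ∀ x (h : E.IsRegular x),
    S (.inl x) = ∑ e ∈ h.1.toFinset, S (.inr e) * star (S (.inr e))

/-- `S_{e₁} ⋯ S_{eₙ} S_y`, where `y` is the end of the walk `e₁, …, eₙ` starting at the given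
vertex. -/
def extendWalk {E : Graph.{v, w}} {A : Type*} [Mul A] (S : E.Vert ⊕ E.Edge → A) :
    E.Vert → List E.Edge → A
  | x, [] => S (.inl x)
  | _, e :: l => S (.inr e) * extendWalk S (E.rng e) l

/-- The extended system `(S_α)_{α ∈ Path(E)}`: it is `S_v` on the path of length `0` at `v`, and
`S_{e₁} ⋯ S_{eₙ} = S_{e₁} ⋯ S_{eₙ} S_{r(eₙ)}` on the path `e₁ ⋯ eₙ`. -/
def extend {E : Graph.{v, w}} {A : Type*} [Mul A] (S : E.Vert ⊕ E.Edge → A) (α : E.Path) : A :=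
  extendWalk S α.source α.edges

/-- `φ : L_R(E) → A` is the `*`-homomorphism associated with `S`: it maps the generators `v`, `e`
and `e*` to `S_v`, `S_e` and `S_e*`. -/
structure IsAssociated {R : Type u} [CommRing R] {E : Graph.{v, w}} {A : Type*} [NonUnitalRing A]
    [StarRing A] [Module R A] (S : E.Vert ⊕ E.Edge → A)
    (φ : LeavittPathAlgebra R E →⋆ₙₐ[R] A) : Prop where
  vert : ∀ x, φ (gen R E (.vert x)) = S (.inl x)
  edge : ∀ e, φ (gen R E (.edge e)) = S (.inr e)
  ghost : ∀ e, φ (gen R E (.ghost e)) = star (S (.inr e))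

/-! ### The free module on the symbols `ξ_τ^n` and its homogeneous endomorphisms -/

section Module

variable (R : Type u) [CommRing R] (E : Graph.{v, w})

/-- The free `R`-module `M` with basis `ξ_τ^n`, for `τ ∈ 𝔗_E` and `n ∈ ℤ`. -/
def TrailModule : Type _ := (E.EssAperiodicTrail × ℤ) →₀ R

instance : AddCommGroup (TrailModule R E) :=
  inferInstanceAs (AddCommGroup ((E.EssAperiodicTrail × ℤ) →₀ R))

instance : Module R (TrailModule R E) :=
  inferInstanceAs (Module R ((E.EssAperiodicTrail × ℤ) →₀ R))

/-- The basis of `M` consisting of the vectors `ξ_τ^n`. -/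
def TrailModule.basis : Module.Basis (E.EssAperiodicTrail × ℤ) R (TrailModule R E) :=
  Finsupp.basisSingleOne

/-- The basis vector `ξ_τ^n`. -/
def xi {E : Graph.{v, w}} (τ : E.EssAperiodicTrail) (n : ℤ) : TrailModule R E :=
  TrailModule.basis R E (τ, n)

/-- `M_i`, the submodule generated by the `ξ_τ^i`. -/
def TrailModule.component (i : ℤ) : Submodule R (TrailModule R E) :=
  Submodule.span R (Set.range fun τ : E.EssAperiodicTrail => xi R τ i)

variable {R E}

/-- `f` is homogeneous of degree `k`: it maps `M_i` into `M_{i+k}` for all `i`. -/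
def IsHomogeneous (k : ℤ) (f : Module.End R (TrailModule R E)) : Prop :=
  ∀ i, (TrailModule.component R E i).map f ≤ TrailModule.component R E (i + k)

/-- The matrices of `f` and `g` in the basis `ξ_τ^n` are transposes of each other. -/
def IsTranspose (f g : Module.End R (TrailModule R E)) : Prop :=
  ∀ (τ σ : E.EssAperiodicTrail) (m n : ℤ),
    (TrailModule.basis R E).repr (f (xi R τ m)) (σ, n) =
      (TrailModule.basis R E).repr (g (xi R σ n)) (τ, m)

/-- The operators `S_α` are given on the basis by `S_α ξ_τ^n = ξ_{ατ}^{n+l(α)}` if `r(α) = s(τ)`,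
and `S_α ξ_τ^n = 0` otherwise. -/
def ActsByConcatenation (T : E.Path → Module.End R (TrailModule R E)) : Prop :=
  ∀ (α : E.Path) (τ : E.EssAperiodicTrail) (n : ℤ),
    (∀ h : α.range = τ.1.source,
      T α (xi R τ n) = xi R (Graph.EssAperiodicTrail.concat α τ h) (α.length + n)) ∧
    (α.range ≠ τ.1.source → T α (xi R τ n) = 0)

end Module

end

end LPA

namespace LPA

noncomputable section

/-! Each of the operators S_v and S_e is a partial injection of the basis, indexed by 𝔗_E × ℤ.
Products correspond to composites and transposes to inverses (`partialPerm_trans`,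
`isTranspose_partialPerm`), so the Cuntz–Krieger relations become statements about trails: a trail
whose source is not a sink is eτ for exactly one pair (e, τ) (`exists_eq_cons`, `cons_inj`). The
universal property of L_R(E) then yields the representation.

For injectivity, fix one special edge at every regular vertex. Since v = ∑ ee*, the product ee* with
e special equals v minus the other summands, so L_R(E) is spanned by the αβ* with r(α) = r(β) in
which α and β do not both end in the same special edge (`span_reduced_eq_top`). Suppose a nontrivial
combination of such elements is mapped to 0. Choose a term α₀β₀* with |α₀| + |β₀| minimal and a
trail τ that starts at r(α₀), and look at the coefficient of ξ^{|α₀|} at α₀τ in the image of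
ξ^{|β₀|} at β₀τ. Another term αβ* can contribute only if α = α₀m, β = β₀m and τ = mρ with m
nonempty; the exponents force the same m on both sides, even when τ is periodic. If τ is generic,
such an m ends in a special edge, against the choice of the spanning set (`eq_of_mem_monomialPerm`).
Thus the coefficient is that of α₀β₀* itself, which is nonzero. Nothing is divided, so any
commutative ring will do.

A generic trail follows special edges at regular vertices and unused edges at infinite emitters for
boundedly many steps, and is arbitrary afterwards (`exists_generic_trail`). This needs an
essentially aperiodic trail at every vertex (`exists_essAperiodicTrail`). If x had none, every
vertex reachable from x would emit an edge and lead to a branching vertex, and a diagonal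
construction against all candidate periods would produce a nonperiodic path. -/

namespace Graph

variable {E : Graph.{v, w}}

/-! ### Unique factorisation of trails -/

/-- The path of length `1` with edge `e`. -/
def edgePath (e : E.Edge) : E.Path := ⟨E.src e, [e], rfl, trivial⟩

theorem concat_source (α : E.Path) (τ : E.Trail) (h : α.range = τ.source) :
    (α.concat τ h).source = α.source := by
  cases τ with
  | finite β hβ => rfl
  | infinite f hf => exact (prepend_isInfinitePath α.isWalk hf h).2

namespace EssAperiodicTrail

/-- The trail `eτ`. -/
def cons (e : E.Edge) (τ : E.EssAperiodicTrail) (h : E.rng e = τ.1.source) :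
    E.EssAperiodicTrail :=
  concat (edgePath e) τ h

theorem source_concat (α : E.Path) (τ : E.EssAperiodicTrail) (h : α.range = τ.1.source) :
    (concat α τ h).1.source = α.source :=
  concat_source α τ.1 h

theorem source_cons (e : E.Edge) (τ : E.EssAperiodicTrail) (h : E.rng e = τ.1.source) :
    (cons e τ h).1.source = E.src e :=
  concat_source (edgePath e) τ.1 h

/-- The first edge and the rest can be read off a trail; a finite rest has its source recovered as
r(e). This is behind S_e*S_e = S_{r(e)} and S_e*S_f = 0. -/
theorem cons_inj {e e' : E.Edge} {τ τ' : E.EssAperiodicTrail} {h : E.rng e = τ.1.source}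
    {h' : E.rng e' = τ'.1.source} (H : cons e τ h = cons e' τ' h') : e = e' ∧ τ = τ' := by
  obtain ⟨τ, hτ⟩ := τ
  obtain ⟨τ', hτ'⟩ := τ'
  have H1 : (edgePath e).concat τ h = (edgePath e').concat τ' h' := congrArg Subtype.val H
  cases τ with
  | finite β hβ =>
    cases τ' with
    | finite β' hβ' =>
      have H2 : e :: β.edges = e' :: β'.edges := congrArg Path.edges (Trail.finite.inj H1)
      obtain ⟨h1, h2⟩ := List.cons.inj H2
      subst h1
      have : β = β' := Path.ext (h.symm.trans h') h2
      subst this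
      exact ⟨rfl, rfl⟩
    | infinite f' hf' => cases H1
  | infinite f hf =>
    cases τ' with
    | finite β' hβ' => cases H1
    | infinite f' hf' =>
      have H2 : prepend [e] f = prepend [e'] f' := Trail.infinite.inj H1
      have h1 : e = e' := congrFun H2 0
      have h2 : f = f' := funext fun n => congrFun H2 (n + 1)
      subst h1 h2
      exact ⟨rfl, rfl⟩

/-- Periodicity and the eventual absence of exits depend only on the tail, so deleting the first
edge stays inside 𝔗_E. This gives the relation at regular vertices. -/
theorem exists_eq_cons (τ : E.EssAperiodicTrail) (hs : ¬ E.IsSink τ.1.source) :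
    ∃ e τ' h, τ = cons e τ' h := by
  obtain ⟨τ, hτ⟩ := τ
  cases τ with
  | finite β hβ =>
    obtain ⟨x, l, hw⟩ := β
    cases l with
    | nil => exact absurd hβ hs
    | cons e l =>
      obtain ⟨rfl, hw⟩ := hw
      exact ⟨e, ⟨.finite ⟨E.rng e, l, hw⟩ hβ, trivial⟩, rfl, rfl⟩
  | infinite f hf =>
    refine ⟨f 0, ⟨.infinite (fun n => f (n + 1)) fun n => hf (n + 1), ?_⟩, hf 0, ?_⟩
    · refine (isEssAperiodic_infinite _).2 ?_
      rintro ⟨j, k, hk, hjk⟩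
      obtain ⟨N, hN⟩ := (isEssAperiodic_infinite hf).1 hτ ⟨j + 1, k, hk, fun n hn => by
        obtain ⟨n, rfl⟩ : ∃ m, n = m + 1 := ⟨n - 1, by omega⟩
        rw [add_right_comm]
        exact hjk n (by omega)⟩
      exact ⟨N, fun n hn => hN (n + 1) (by omega)⟩
    · apply Subtype.ext
      have : f = prepend [f 0] fun n => f (n + 1) := by
        funext n
        cases n <;> rfl
      change Trail.infinite f hf = Trail.infinite (prepend [f 0] fun n => f (n + 1)) _
      congr 1

/-- `σ = lτ` for the list of edges `l`. -/
def IsConcat : List E.Edge → E.EssAperiodicTrail → E.EssAperiodicTrail → Prop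
  | [], τ, σ => τ = σ
  | e :: l, τ, σ => ∃ ρ h, IsConcat l τ ρ ∧ σ = cons e ρ h

theorem concat_nil (x : E.Vert) (hw : E.IsWalk x []) (τ : E.EssAperiodicTrail)
    (h : (⟨x, [], hw⟩ : E.Path).range = τ.1.source) : concat ⟨x, [], hw⟩ τ h = τ := by
  obtain ⟨τ, hτ⟩ := τ
  apply Subtype.ext
  cases τ with
  | finite β hβ =>
    have : Path.append ⟨x, [], hw⟩ β h = β := Path.ext h rfl
    change Trail.finite (Path.append ⟨x, [], hw⟩ β h) _ = Trail.finite β hβ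
    congr 1
  | infinite f hf => rfl

theorem concat_cons (x : E.Vert) (e : E.Edge) (l : List E.Edge) (hw : E.IsWalk x (e :: l))
    (τ : E.EssAperiodicTrail) (h : (⟨x, e :: l, hw⟩ : E.Path).range = τ.1.source) :
    concat ⟨x, e :: l, hw⟩ τ h =
      cons e (concat ⟨E.rng e, l, hw.2⟩ τ h) (source_concat ⟨E.rng e, l, hw.2⟩ τ h).symm := by
  obtain ⟨rfl, hw⟩ := hw
  obtain ⟨τ, hτ⟩ := τ
  cases τ <;> rfl

/-- Passes between edge-by-edge and pathwise concatenation. The source has to be prescribed because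
an empty list of edges does not record its vertex. -/
theorem isConcat_iff {x : E.Vert} {l : List E.Edge} (hw : E.IsWalk x l)
    {τ σ : E.EssAperiodicTrail} :
    IsConcat l τ σ ∧ σ.1.source = x ↔ ∃ h, σ = concat ⟨x, l, hw⟩ τ h := by
  induction l generalizing x σ with
  | nil =>
    constructor
    · rintro ⟨h1, h2⟩
      cases h1
      exact ⟨h2.symm, (concat_nil _ _ _ _).symm⟩
    · rintro ⟨h, rfl⟩
      exact ⟨(concat_nil _ _ _ _).symm, concat_source _ _ _⟩
  | cons e l ih =>
    constructor
    · rintro ⟨⟨ρ, h, h1, rfl⟩, h2⟩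
      obtain ⟨h3, rfl⟩ := (ih hw.2).1 ⟨h1, h.symm⟩
      exact ⟨h3, (concat_cons x e l hw τ h3).symm⟩
    · rintro ⟨h, rfl⟩
      refine ⟨⟨concat ⟨E.rng e, l, hw.2⟩ τ h, (source_concat ⟨E.rng e, l, hw.2⟩ τ h).symm,
        ((ih hw.2).2 ⟨h, rfl⟩).1, concat_cons x e l hw τ h⟩, concat_source _ _ _⟩

/-- Two prefixes of one trail are comparable: `cons_inj` strips their common edges one at a time. -/
theorem isConcat_cancel {l l' : List E.Edge} {τ τ' σ : E.EssAperiodicTrail} (h : IsConcat l τ σ)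
    (h' : IsConcat l' τ' σ) (hl : l.length ≤ l'.length) :
    ∃ m, l' = l ++ m ∧ IsConcat m τ' τ := by
  induction l generalizing l' σ with
  | nil =>
    cases h
    exact ⟨l', rfl, h'⟩
  | cons e l ih =>
    cases l' with
    | nil => simp at hl
    | cons e' l' =>
      obtain ⟨ρ, _, h1, rfl⟩ := h
      obtain ⟨ρ', _, h1', h2⟩ := h'
      obtain ⟨rfl, rfl⟩ := cons_inj h2
      obtain ⟨m, rfl, hm⟩ := ih h1 h1' (by simpa using hl)
      exact ⟨m, rfl, hm⟩

end EssAperiodicTrail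

/-! ### Every vertex is the source of an essentially aperiodic trail -/

theorem isWalk_getElem {x : E.Vert} {l : List E.Edge} (hl : E.IsWalk x l) (i : ℕ)
    (hi : i + 1 < l.length) : E.rng l[i] = E.src l[i + 1] := by
  induction l generalizing x i with
  | nil => simp at hi
  | cons e l ih =>
    cases i with
    | zero =>
      cases l with
      | nil => simp at hi
      | cons a l => exact hl.2.1.symm
    | succ i => exact ih hl.2 i (by simpa using hi)

theorem isWalk_src_head {x : E.Vert} {l : List E.Edge} (hl : E.IsWalk x l)
    (h : 0 < l.length) : E.src l[0] = x := by
  cases l with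
  | nil => simp at h
  | cons e l => exact hl.1

/-- No essentially aperiodic trail starts at `x`. -/
def HasNoTrail (E : Graph.{v, w}) (x : E.Vert) : Prop :=
  ∀ τ : E.EssAperiodicTrail, τ.1.source ≠ x

theorem HasNoTrail.exists_edge {x : E.Vert} (h : E.HasNoTrail x) : ∃ e, E.src e = x := by
  by_contra! hx
  refine h ⟨.finite ⟨x, [], trivial⟩ ?_, trivial⟩ rfl
  exact Set.eq_empty_iff_forall_notMem.2 hx

/-- A trail at r(e) could be prolonged backwards by e, so the defect spreads along all walks. -/
theorem HasNoTrail.rng {e : E.Edge} (h : E.HasNoTrail (E.src e)) : E.HasNoTrail (E.rng e) :=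
  fun τ hτ => h _ (EssAperiodicTrail.source_cons e τ hτ.symm)

theorem HasNoTrail.walkEnd {x : E.Vert} (h : E.HasNoTrail x) {l : List E.Edge}
    (hl : E.IsWalk x l) : E.HasNoTrail (E.walkEnd x l) := by
  induction l generalizing x with
  | nil => exact h
  | cons e l ih =>
    obtain ⟨rfl, hl⟩ := hl
    exact ih h.rng hl

/-- Otherwise the forced continuation from x is an infinite path without any exit, which is
essentially aperiodic whether it is periodic or not. -/
theorem HasNoTrail.exists_branching {x : E.Vert} (h : E.HasNoTrail x) :
    ∃ l, E.IsWalk x l ∧ ∃ a b, E.src a = E.walkEnd x l ∧ E.src b = E.walkEnd x l ∧ a ≠ b := by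
  by_contra! hx
  choose nxt hnxt using fun y : {y // E.HasNoTrail y} => y.2.exists_edge
  let y : ℕ → {y // E.HasNoTrail y} := fun n => Nat.rec ⟨x, h⟩
    (fun _ z => ⟨E.rng (nxt z), HasNoTrail.rng (by rw [hnxt]; exact z.2)⟩) n
  have hreach : ∀ n, ∃ l, E.IsWalk x l ∧ E.walkEnd x l = (y n).1 := by
    intro n
    induction n with
    | zero => exact ⟨[], trivial, rfl⟩
    | succ n ih =>
      obtain ⟨l, hl, hn⟩ := ih
      refine ⟨l ++ [nxt (y n)], isWalk_append hl ⟨?_, trivial⟩, ?_⟩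
      · rw [hnxt, hn]
      · rw [walkEnd_append]; rfl
  have hf : IsInfinitePath fun n => nxt (y n) := fun n => (hnxt (y (n + 1))).symm
  refine h ⟨.infinite _ hf, (isEssAperiodic_infinite hf).2 fun _ => ⟨0, fun n _ e he => ?_⟩⟩
    (hnxt (y 0))
  obtain ⟨l, hl, hn⟩ := hreach n
  exact hx l hl e _ (by rw [he, hnxt, hn]) (by rw [hnxt, hn])

theorem HasNoTrail.exists_long {x : E.Vert} (h : E.HasNoTrail x) (n : ℕ) :
    ∃ l, E.IsWalk x l ∧ l.length = n := by
  induction n generalizing x with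
  | zero => exact ⟨[], trivial, rfl⟩
  | succ n ih =>
    obtain ⟨e, rfl⟩ := h.exists_edge
    obtain ⟨l, hl, hn⟩ := ih h.rng
    exact ⟨e :: l, ⟨rfl, hl⟩, by simp [hn]⟩

/-- Every walk out of `x` extends so that `RepeatsFrom f j k` fails for all infinite paths `f`
that continue it. -/
theorem HasNoTrail.exists_extension {x : E.Vert} (h : E.HasNoTrail x) {l : List E.Edge}
    (hl : E.IsWalk x l) (j k : ℕ) :
    ∃ m, E.IsWalk x m ∧ l <+: m ∧ l.length < m.length ∧
      ∀ f : ℕ → E.Edge, (∀ n (hn : n < m.length), m[n] = f n) → ¬ RepeatsFrom f j k := by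
  obtain ⟨l₁, hl₁, hlen⟩ := (h.walkEnd hl).exists_long (j + k)
  have h₁ := isWalk_append hl hl₁
  obtain ⟨l₂, hl₂, a, b, ha, hb, hab⟩ := (h.walkEnd h₁).exists_branching
  have h₂ := isWalk_append h₁ hl₂
  rw [← walkEnd_append] at ha hb
  set p := l ++ l₁ ++ l₂ with hp
  have hplen : j + k ≤ p.length := by simp [hp]; omega
  -- One of the two edges at the branching vertex differs from the edge k places back. Appending it
  -- violates period k at the index |p| - k ≥ j; for k = 0 the condition is vacuous.
  obtain ⟨c, hc, hne⟩ : ∃ c, E.src c = E.walkEnd x p ∧ ∀ q, p[p.length - k]? = some q → c ≠ q := by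
    by_cases hq : p[p.length - k]? = some a
    · exact ⟨b, hb, fun q h' => by rw [hq] at h'; cases h'; exact hab.symm⟩
    · exact ⟨a, ha, fun q h' e => hq (e ▸ h')⟩
  refine ⟨p ++ [c], isWalk_append h₂ ⟨hc, trivial⟩, ⟨l₁ ++ l₂ ++ [c], by simp [hp]⟩,
    by simp [hp], fun f hf hrep => ?_⟩
  have hk := hrep.1
  have h3 := hrep.2 (p.length - k) (by omega)
  rw [Nat.sub_add_cancel (by omega), ← hf p.length (by simp),
    ← hf (p.length - k) (by simp)] at h3
  rw [List.getElem_append_right le_rfl, List.getElem_append_left (by omega)] at h3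
  simp only [Nat.sub_self, List.getElem_cons_zero] at h3
  exact hne _ (List.getElem?_eq_getElem (by omega)) h3

/-- Diagonal argument: if x has no trail, there is an increasing chain of walks from x that rules
out the countably many pairs (j, k) in turn. Its limit is not periodic, hence is a trail after all.
-/
theorem exists_essAperiodicTrail (x : E.Vert) : ∃ τ : E.EssAperiodicTrail, τ.1.source = x := by
  by_contra! h
  change E.HasNoTrail x at h
  choose ext hwalk hpre hlen hkill using
    fun l : {l // E.IsWalk x l} => h.exists_extension l.2
  -- Stage i treats the pair encoded by i.
  let L : ℕ → {l // E.IsWalk x l} := fun n => Nat.rec ⟨[], trivial⟩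
    (fun i l => ⟨ext l i.unpair.1 i.unpair.2, hwalk l _ _⟩) n
  have hstep : ∀ i, (L i).1 <+: (L (i + 1)).1 := fun i => hpre (L i) _ _
  have hmono : ∀ i j, i ≤ j → (L i).1 <+: (L j).1 := fun i j hij =>
    Nat.le_induction (List.prefix_refl _) (fun j _ ih => ih.trans (hstep j)) j hij
  have hL : ∀ i, i ≤ (L i).1.length := by
    intro i
    induction i with
    | zero => exact Nat.zero_le _
    | succ i ih => exact Nat.succ_le_of_lt (ih.trans_lt (hlen (L i) _ _))
  -- The walk at stage n + 1 has length at least n + 1, so its entry number n exists.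
  let f : ℕ → E.Edge := fun n => (L (n + 1)).1[n]'(hL (n + 1))
  have hf : ∀ i n (hn : n < (L i).1.length), (L i).1[n] = f n := by
    intro i n hn
    rcases le_total i (n + 1) with hi | hi
    · exact (hmono _ _ hi).getElem hn
    · exact ((hmono _ _ hi).getElem (hL (n + 1))).symm
  have hpath : IsInfinitePath f := by
    intro n
    have h2 := hL (n + 2)
    rw [← hf (n + 2) n (by omega), ← hf (n + 2) (n + 1) (by omega)]
    exact isWalk_getElem (L (n + 2)).2 n (by omega)
  refine h ⟨.infinite f hpath, (isEssAperiodic_infinite hpath).2 ?_⟩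
    (isWalk_src_head (L 1).2 (hL 1))
  rintro ⟨j, k, hjk⟩
  refine absurd hjk (hkill (L (Nat.pair j k)) j k f fun n hn => ?_)
  have := hf (Nat.pair j k + 1) n
  simp only [L, Nat.unpair_pair] at this
  exact this hn

/-! ### Special edges and generic trails -/

/-- `e` is the edge chosen among those emitted by a regular vertex. -/
def IsSpecial (e : E.Edge) : Prop := ∃ h : E.IsRegular (E.src e), h.2.some = e

theorem IsRegular.exists_special {x : E.Vert} (h : E.IsRegular x) :
    ∃ e, E.src e = x ∧ IsSpecial e := by
  have hx : E.src h.2.some = x := h.2.some_mem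
  exact ⟨h.2.some, hx, hx.symm ▸ h, by simp only [hx]⟩

/-- The choice of the special edge depends only on the vertex. -/
theorem IsSpecial.eq {e f : E.Edge} (he : IsSpecial e) (hf : IsSpecial f)
    (h : E.src e = E.src f) : e = f := by
  obtain ⟨h1, h2⟩ := he
  obtain ⟨h3, h4⟩ := hf
  rw [← h2, ← h4]
  simp only [h]

/-- Given finitely many edges, every vertex is the source of a trail whose prefixes of
length at most `N` with all edges among the given ones end in a special edge. -/
theorem exists_generic_trail (N : ℕ) (F : Set E.Edge) (hF : F.Finite) (x : E.Vert) :
    ∃ τ : E.EssAperiodicTrail, τ.1.source = x ∧ ∀ l e τ',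
      EssAperiodicTrail.IsConcat (l ++ [e]) τ' τ → l.length < N → (∀ a ∈ l ++ [e], a ∈ F) →
        IsSpecial e := by
  induction N generalizing x with
  | zero =>
    obtain ⟨τ, hτ⟩ := exists_essAperiodicTrail x
    exact ⟨τ, hτ, fun l e τ' _ h => absurd h (Nat.not_lt_zero _)⟩
  | succ N ih =>
    by_cases hs : E.IsSink x
    · refine ⟨⟨.finite ⟨x, [], trivial⟩ hs, trivial⟩, rfl, fun l e τ' h => ?_⟩
      have : ∃ a m, l ++ [e] = a :: m := by cases l <;> simp
      obtain ⟨a, m, hm⟩ := this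
      rw [hm] at h
      obtain ⟨ρ, h1, -, h2⟩ := h
      have h3 := EssAperiodicTrail.source_cons a ρ h1
      rw [← h2] at h3
      exact absurd h3.symm (Set.eq_empty_iff_forall_notMem.1 hs a)
    -- A vertex that is not a sink is regular or an infinite emitter: the former offers its special
    -- edge, the latter an edge outside the finite set `F`.
    · obtain ⟨e₀, rfl, he₀⟩ : ∃ e₀, E.src e₀ = x ∧ (e₀ ∈ F → IsSpecial e₀) := by
        by_cases hfin : {e : E.Edge | E.src e = x}.Finite
        · obtain ⟨e, he, he'⟩ := IsRegular.exists_special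
            ⟨hfin, Set.nonempty_iff_ne_empty.2 hs⟩
          exact ⟨e, he, fun _ => he'⟩
        · obtain ⟨e, he, he'⟩ := (Set.Infinite.sdiff hfin hF).nonempty
          exact ⟨e, he, fun h => absurd h he'⟩
      obtain ⟨τ, hτ, H⟩ := ih (E.rng e₀)
      refine ⟨.cons e₀ τ hτ.symm, EssAperiodicTrail.source_cons _ _ _, fun l e τ' h hl ha => ?_⟩
      cases l with
      | nil =>
        obtain ⟨ρ, _, _, h2⟩ := h
        obtain ⟨rfl, rfl⟩ := EssAperiodicTrail.cons_inj h2
        exact he₀ (ha _ (by simp))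
      | cons a l =>
        obtain ⟨ρ, _, h1, h2⟩ := h
        obtain ⟨rfl, rfl⟩ := EssAperiodicTrail.cons_inj h2
        exact H l e τ' h1 (by simpa using hl) fun b hb => ha b (List.mem_cons_of_mem _ hb)

end Graph

/-! ### Matrices of endomorphisms of the free module on the symbols `ξ_τ^n` -/

section Matrix

variable {R : Type u} [CommRing R] {E : Graph.{v, w}}

/-- The coefficient of `ξ_y` in `f ξ_x`. -/
def entry (f : Module.End R (TrailModule R E)) (x y : E.EssAperiodicTrail × ℤ) : R :=
  (TrailModule.basis R E).repr (f (TrailModule.basis R E x)) y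

theorem end_ext {f g : Module.End R (TrailModule R E)} (h : ∀ x y, entry f x y = entry g x y) :
    f = g :=
  (TrailModule.basis R E).ext fun x => (TrailModule.basis R E).repr.injective (Finsupp.ext (h x))

@[simp] theorem entry_add (f g : Module.End R (TrailModule R E)) (x y) :
    entry (f + g) x y = entry f x y + entry g x y := by simp [entry]

@[simp] theorem entry_smul (r : R) (f : Module.End R (TrailModule R E)) (x y) :
    entry (r • f) x y = r * entry f x y := by simp [entry]

@[simp] theorem entry_zero (x y) : entry (0 : Module.End R (TrailModule R E)) x y = 0 := by
  simp [entry]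

theorem entry_one (x y) :
    entry (1 : Module.End R (TrailModule R E)) x y = Finsupp.single x 1 y := by
  simp [entry]

theorem entry_sum {ι : Type*} (s : Finset ι) (f : ι → Module.End R (TrailModule R E)) (x y) :
    entry (∑ i ∈ s, f i) x y = ∑ i ∈ s, entry (f i) x y := by
  simp [entry, LinearMap.sum_apply, Finsupp.finsetSum_apply]

/-- The sum has finite support because g sends a basis vector to a finite combination. Stated with
`finsum`, the formula mentions no support and can be transposed term by term. -/
theorem entry_mul (f g : Module.End R (TrailModule R E)) (x y) :
    entry (f * g) x y = ∑ᶠ z, entry g x z * entry f z y := by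
  have h : g (TrailModule.basis R E x) =
      ((TrailModule.basis R E).repr (g (TrailModule.basis R E x))).sum
        fun z a => a • TrailModule.basis R E z :=
    ((TrailModule.basis R E).linearCombination_repr _).symm
  have h2 : entry (f * g) x y = ((TrailModule.basis R E).repr (g (TrailModule.basis R E x))).sum
      fun z a => a * entry f z y := by
    rw [entry, Module.End.mul_apply, h, map_finsuppSum, map_finsuppSum, Finsupp.sum,
      Finsupp.finsetSum_apply, ← h]
    simp [Finsupp.sum, entry]
  rw [h2, Finsupp.sum, finsum_eq_sum_of_support_subset]
  · rfl
  · intro z hz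
    simp only [Function.mem_support] at hz
    simp only [Finset.mem_coe, Finsupp.mem_support_iff]
    exact fun h0 => hz (by rw [entry, h0, zero_mul])

theorem isTranspose_iff {f g : Module.End R (TrailModule R E)} :
    IsTranspose f g ↔ ∀ x y, entry f x y = entry g y x :=
  ⟨fun h x y => h x.1 y.1 x.2 y.2, fun h τ σ m n => h (τ, m) (σ, n)⟩

theorem mem_component_iff {i : ℤ} {x : TrailModule R E} :
    x ∈ TrailModule.component R E i ↔ ∀ y, y.2 ≠ i → (TrailModule.basis R E).repr x y = 0 := by
  have : (Set.range fun τ : E.EssAperiodicTrail => xi R τ i) =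
      TrailModule.basis R E '' {y | y.2 = i} := by
    ext z
    constructor
    · rintro ⟨τ, rfl⟩
      exact ⟨(τ, i), rfl, rfl⟩
    · rintro ⟨⟨τ, _⟩, rfl, rfl⟩
      exact ⟨τ, rfl⟩
  rw [TrailModule.component, this, Module.Basis.mem_span_image]
  constructor
  · intro h y hy
    by_contra hne
    exact hy (h (Finsupp.mem_support_iff.2 hne))
  · intro h y hy
    by_contra hne
    exact Finsupp.mem_support_iff.1 hy (h y hne)

theorem isHomogeneous_iff {k : ℤ} {f : Module.End R (TrailModule R E)} :
    IsHomogeneous k f ↔ ∀ x y, y.2 ≠ x.2 + k → entry f x y = 0 := by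
  constructor
  · intro h x y hy
    exact mem_component_iff.1
      (h x.2 ⟨_, Submodule.subset_span ⟨x.1, rfl⟩, rfl⟩) y hy
  · intro h i
    rw [TrailModule.component, Submodule.map_span_le]
    rintro _ ⟨τ, rfl⟩
    exact mem_component_iff.2 fun y hy => h (τ, i) y hy

/-! ### Transposes and homogeneous endomorphisms -/

theorem IsTranspose.symm {f g : Module.End R (TrailModule R E)} (h : IsTranspose f g) :
    IsTranspose g f := fun τ σ m n => (h σ τ n m).symm

theorem IsTranspose.unique {f g g' : Module.End R (TrailModule R E)} (h : IsTranspose f g)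
    (h' : IsTranspose f g') : g = g' :=
  end_ext fun x y => by rw [← isTranspose_iff.1 h y x, isTranspose_iff.1 h' y x]

theorem IsTranspose.add {f g f' g' : Module.End R (TrailModule R E)} (h : IsTranspose f g)
    (h' : IsTranspose f' g') : IsTranspose (f + f') (g + g') :=
  isTranspose_iff.2 fun x y => by
    rw [entry_add, entry_add, isTranspose_iff.1 h, isTranspose_iff.1 h']

theorem IsTranspose.smul (r : R) {f g : Module.End R (TrailModule R E)} (h : IsTranspose f g) :
    IsTranspose (r • f) (r • g) :=
  isTranspose_iff.2 fun x y => by rw [entry_smul, entry_smul, isTranspose_iff.1 h]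

theorem isTranspose_zero : IsTranspose (0 : Module.End R (TrailModule R E)) 0 :=
  isTranspose_iff.2 fun x y => by rw [entry_zero, entry_zero]

theorem isTranspose_one : IsTranspose (1 : Module.End R (TrailModule R E)) 1 :=
  isTranspose_iff.2 fun x y => by
    classical
    simp only [entry_one, Finsupp.single_apply, eq_comm]

/-- Commutativity of R is what lets the entries be swapped. -/
theorem IsTranspose.mul {f g f' g' : Module.End R (TrailModule R E)} (h : IsTranspose f g)
    (h' : IsTranspose f' g') : IsTranspose (f * f') (g' * g) :=
  isTranspose_iff.2 fun x y => by
    rw [entry_mul, entry_mul]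
    refine finsum_congr fun z => ?_
    rw [isTranspose_iff.1 h, isTranspose_iff.1 h', mul_comm]

variable (R E) in
/-- The homogeneous endomorphisms of degree `k` that have a transpose. -/
def homogeneousEnd (k : ℤ) : Submodule R (Module.End R (TrailModule R E)) where
  carrier := {f | IsHomogeneous k f ∧ ∃ g, IsTranspose f g}
  add_mem' := by
    rintro f f' ⟨h, g, hg⟩ ⟨h', g', hg'⟩
    refine ⟨isHomogeneous_iff.2 fun x y hy => ?_, _, hg.add hg'⟩
    rw [entry_add, isHomogeneous_iff.1 h x y hy, isHomogeneous_iff.1 h' x y hy, add_zero]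
  zero_mem' := ⟨isHomogeneous_iff.2 fun x y _ => entry_zero x y, 0, isTranspose_zero⟩
  smul_mem' := by
    rintro r f ⟨h, g, hg⟩
    refine ⟨isHomogeneous_iff.2 fun x y hy => ?_, _, hg.smul r⟩
    rw [entry_smul, isHomogeneous_iff.1 h x y hy, mul_zero]

theorem one_mem_homogeneousEnd : 1 ∈ homogeneousEnd R E 0 :=
  ⟨isHomogeneous_iff.2 fun x y hy => by
    rw [entry_one, Finsupp.single_eq_of_ne]
    rintro rfl
    exact hy (add_zero _).symm, 1, isTranspose_one⟩

theorem mul_mem_homogeneousEnd {j k : ℤ} {f g : Module.End R (TrailModule R E)}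
    (hf : f ∈ homogeneousEnd R E j) (hg : g ∈ homogeneousEnd R E k) :
    f * g ∈ homogeneousEnd R E (j + k) := by
  obtain ⟨hf, f', hf'⟩ := hf
  obtain ⟨hg, g', hg'⟩ := hg
  refine ⟨isHomogeneous_iff.2 fun x y hy => ?_, _, hf'.mul hg'⟩
  rw [entry_mul, finsum_eq_zero_of_forall_eq_zero]
  intro z
  by_cases hz : z.2 = x.2 + k
  · rw [isHomogeneous_iff.1 hf z y (by omega), mul_zero]
  · rw [isHomogeneous_iff.1 hg x z hz, zero_mul]

theorem transpose_mem_homogeneousEnd {k : ℤ} {f g : Module.End R (TrailModule R E)}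
    (hf : f ∈ homogeneousEnd R E k) (hg : IsTranspose f g) : g ∈ homogeneousEnd R E (-k) :=
  ⟨isHomogeneous_iff.2 fun x y hy => by
    rw [← isTranspose_iff.1 hg]
    exact isHomogeneous_iff.1 hf.1 _ _ (by omega), f, hg.symm⟩

/-! ### The algebra 𝓔, its involution and its grading -/

variable (R E) in
/-- The algebra `𝓔`, the sum of the spaces of homogeneous endomorphisms with a transpose. -/
def gradedEnd : Subalgebra R (Module.End R (TrailModule R E)) :=
  Submodule.toSubalgebra (⨆ k, homogeneousEnd R E k)
    (Submodule.mem_iSup_of_mem 0 one_mem_homogeneousEnd) (by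
      intro f g hf hg
      induction hf using Submodule.iSup_induction' with
      | mem j f hf =>
        induction hg using Submodule.iSup_induction' with
        | mem k g hg => exact Submodule.mem_iSup_of_mem _ (mul_mem_homogeneousEnd hf hg)
        | zero => rw [mul_zero]; exact zero_mem _
        | add x y _ _ hx hy => rw [mul_add]; exact add_mem hx hy
      | zero => rw [zero_mul]; exact zero_mem _
      | add x y _ _ hx hy => rw [add_mul]; exact add_mem hx hy)

theorem mem_gradedEnd_of_homogeneous {k : ℤ} {f : Module.End R (TrailModule R E)}
    (hf : f ∈ homogeneousEnd R E k) : f ∈ gradedEnd R E :=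
  (Submodule.mem_iSup_of_mem k hf : f ∈ ⨆ k, homogeneousEnd R E k)

theorem exists_transpose {f : Module.End R (TrailModule R E)} (hf : f ∈ gradedEnd R E) :
    ∃ g ∈ gradedEnd R E, IsTranspose f g := by
  change f ∈ ⨆ k, homogeneousEnd R E k at hf
  induction hf using Submodule.iSup_induction' with
  | mem k f hf =>
    obtain ⟨g, hg⟩ := hf.2
    exact ⟨g, mem_gradedEnd_of_homogeneous (transpose_mem_homogeneousEnd hf hg), hg⟩
  | zero => exact ⟨0, zero_mem _, isTranspose_zero⟩
  | add x y _ _ hx hy =>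
    obtain ⟨g, hg, hgt⟩ := hx
    obtain ⟨g', hg', hgt'⟩ := hy
    exact ⟨g + g', add_mem hg hg', hgt.add hgt'⟩

/-- The transpose of an element of `𝓔`. -/
def transpose (a : gradedEnd R E) : gradedEnd R E :=
  ⟨(exists_transpose a.2).choose, (exists_transpose a.2).choose_spec.1⟩

theorem isTranspose_transpose (a : gradedEnd R E) :
    IsTranspose (a : Module.End R (TrailModule R E)) (transpose a : gradedEnd R E) :=
  (exists_transpose a.2).choose_spec.2

theorem transpose_eq {a b : gradedEnd R E}
    (h : IsTranspose (a : Module.End R (TrailModule R E)) (b : Module.End R (TrailModule R E))) :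
    transpose a = b :=
  Subtype.ext ((isTranspose_transpose a).unique h)

/-- Transposition is an involution of `𝓔`. -/
instance gradedEndStarRing : StarRing (gradedEnd R E) where
  star := transpose
  star_involutive a := transpose_eq (isTranspose_transpose a).symm
  star_mul a b := transpose_eq ((isTranspose_transpose a).mul (isTranspose_transpose b))
  star_add a b := transpose_eq ((isTranspose_transpose a).add (isTranspose_transpose b))

theorem star_eq_of_isTranspose {a b : gradedEnd R E}
    (h : IsTranspose (a : Module.End R (TrailModule R E)) (b : Module.End R (TrailModule R E))) :
    star a = b :=
  transpose_eq h

theorem gradedEnd_star_smul (r : R) (a : gradedEnd R E) : star (r • a) = r • star a :=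
  star_eq_of_isTranspose ((isTranspose_transpose a).smul r)

variable (R E) in
/-- The grading of `𝓔`. -/
def grading (k : ℤ) : Submodule R (gradedEnd R E) :=
  (homogeneousEnd R E k).comap (gradedEnd R E).val.toLinearMap

theorem mem_grading {k : ℤ} {a : gradedEnd R E} :
    a ∈ grading R E k ↔ (a : Module.End R (TrailModule R E)) ∈ homogeneousEnd R E k := Iff.rfl

instance : SetLike.GradedMonoid (grading R E) where
  one_mem := one_mem_homogeneousEnd
  mul_mem _ _ _ _ ha hb := mul_mem_homogeneousEnd ha hb

/-- A matrix position sees only the component whose degree is the difference of the two exponents.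
Hence the sum determines all its components, and the sum of the degree spaces is direct. -/
theorem entry_coeAddMonoidHom (x : DirectSum ℤ fun k => grading R E k) (y z) :
    entry (DirectSum.coeAddMonoidHom (grading R E) x).1 y z = entry (x (z.2 - y.2)).1.1 y z := by
  induction x using DirectSum.induction_on with
  | zero => rw [map_zero]; rfl
  | of k a =>
    rw [DirectSum.coeAddMonoidHom_of]
    by_cases hk : k = z.2 - y.2
    · subst hk
      rw [DirectSum.of_eq_same]
    · rw [DirectSum.of_eq_of_ne _ _ _ (Ne.symm hk),
        isHomogeneous_iff.1 (mem_grading.1 a.2).1 y z (by omega)]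
      exact (entry_zero y z).symm
  | add a b ha hb =>
    rw [map_add, DirectSum.add_apply]
    exact (entry_add _ _ y z).trans ((congrArg₂ _ ha hb).trans (entry_add _ _ y z).symm)

variable (R E) in
theorem grading_isInternal : DirectSum.IsInternal (grading R E) := by
  constructor
  · intro a b hab
    refine DFinsupp.ext fun k => Subtype.ext (Subtype.ext (end_ext fun y z => ?_))
    by_cases hz : z.2 = y.2 + k
    · obtain rfl : k = z.2 - y.2 := by omega
      exact (entry_coeAddMonoidHom a y z).symm.trans
        ((congrArg (fun c : gradedEnd R E => entry c.1 y z) hab).trans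
          (entry_coeAddMonoidHom b y z))
    · rw [isHomogeneous_iff.1 (mem_grading.1 (a k).2).1 y z hz,
        isHomogeneous_iff.1 (mem_grading.1 (b k).2).1 y z hz]
  · rintro ⟨f, hf⟩
    change f ∈ ⨆ k, homogeneousEnd R E k at hf
    induction hf using Submodule.iSup_induction' with
    | mem k f hf =>
      exact ⟨DirectSum.of (fun k => grading R E k) k
        ⟨⟨f, mem_gradedEnd_of_homogeneous hf⟩, hf⟩, DirectSum.coeAddMonoidHom_of _ _ _⟩
    | zero => exact ⟨0, map_zero _⟩
    | add x y _ _ hx hy =>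
      obtain ⟨a, ha⟩ := hx
      obtain ⟨b, hb⟩ := hy
      exact ⟨a + b, by rw [map_add, ha, hb]; rfl⟩

/-! ### Partial injections of the basis -/

/-- The endomorphism that permutes the basis vectors according to `p`, and is `0` on the basis
vectors outside the domain of `p`. -/
def partialPerm (p : (E.EssAperiodicTrail × ℤ) ≃. (E.EssAperiodicTrail × ℤ)) :
    Module.End R (TrailModule R E) :=
  (TrailModule.basis R E).constr R fun x => (p x).elim 0 (TrailModule.basis R E)

variable {p q : (E.EssAperiodicTrail × ℤ) ≃. (E.EssAperiodicTrail × ℤ)}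

theorem partialPerm_basis (x : E.EssAperiodicTrail × ℤ) :
    partialPerm (R := R) p (TrailModule.basis R E x) = (p x).elim 0 (TrailModule.basis R E) :=
  Module.Basis.constr_basis _ _ _ _

theorem partialPerm_of_mem {x y : E.EssAperiodicTrail × ℤ} (h : y ∈ p x) :
    partialPerm (R := R) p (TrailModule.basis R E x) = TrailModule.basis R E y := by
  rw [partialPerm_basis, Option.mem_def.1 h]; rfl

theorem partialPerm_of_forall_notMem {x : E.EssAperiodicTrail × ℤ} (h : ∀ y, y ∉ p x) :
    partialPerm (R := R) p (TrailModule.basis R E x) = 0 := by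
  rw [partialPerm_basis, Option.eq_none_iff_forall_not_mem.2 h]; rfl

theorem entry_partialPerm_of_mem {x y : E.EssAperiodicTrail × ℤ} (h : y ∈ p x) :
    entry (partialPerm (R := R) p) x y = 1 := by
  rw [entry, partialPerm_of_mem h]; simp

theorem entry_partialPerm_of_notMem {x y : E.EssAperiodicTrail × ℤ} (h : y ∉ p x) :
    entry (partialPerm (R := R) p) x y = 0 := by
  rw [entry, partialPerm_basis]
  cases hp : p x with
  | none => simp
  | some z =>
    simp only [Option.elim, Module.Basis.repr_self]
    refine Finsupp.single_eq_of_ne ?_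
    rintro rfl
    exact h hp

theorem partialPerm_trans : partialPerm (R := R) (p.trans q) = partialPerm q * partialPerm p := by
  refine (TrailModule.basis R E).ext fun x => ?_
  rw [Module.End.mul_apply, partialPerm_basis, partialPerm_basis]
  change ((p x).bind q).elim _ _ = _
  cases p x with
  | none => simp
  | some y => simp [partialPerm_basis]

/-- Transposing a 0-1 matrix reverses its relation, which here is the graph of a partial injection.
This makes S_e* explicit as the removal of e. -/
theorem isTranspose_partialPerm :
    IsTranspose (partialPerm (R := R) p) (partialPerm p.symm) := by
  refine isTranspose_iff.2 fun x y => ?_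
  by_cases h : y ∈ p x
  · rw [entry_partialPerm_of_mem h, entry_partialPerm_of_mem ((p.mem_iff_mem).2 h)]
  · rw [entry_partialPerm_of_notMem h, entry_partialPerm_of_notMem (mt (p.mem_iff_mem).1 h)]

theorem partialPerm_mem_homogeneousEnd {k : ℤ} (h : ∀ x y, y ∈ p x → y.2 = x.2 + k) :
    partialPerm p ∈ homogeneousEnd R E k :=
  ⟨isHomogeneous_iff.2 fun x y hy => entry_partialPerm_of_notMem fun hxy => hy (h x y hxy),
    _, isTranspose_partialPerm⟩

theorem partialPerm_eq_zero (h : ∀ x y, y ∉ p x) : partialPerm (R := R) p = 0 :=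
  end_ext fun x y => by rw [entry_partialPerm_of_notMem (h x y), entry_zero]

end Matrix

/-! ### The operators `S_v` and `S_e` -/

section Operators

variable {E : Graph.{v, w}}

open LPA.Graph LPA.Graph.EssAperiodicTrail

open Classical in
/-- The partial identity on the `(τ, n)` with `s(τ) = x`. -/
def vertPerm (x : E.Vert) : (E.EssAperiodicTrail × ℤ) ≃. (E.EssAperiodicTrail × ℤ) :=
  PEquiv.ofSet {y | y.1.1.source = x}

theorem mem_vertPerm {x : E.Vert} {y z : E.EssAperiodicTrail × ℤ} :
    z ∈ vertPerm x y ↔ z = y ∧ y.1.1.source = x := by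
  classical
  rw [vertPerm, PEquiv.mem_ofSet_iff]
  constructor <;> (rintro ⟨rfl, h⟩; exact ⟨rfl, h⟩)

open Classical in
/-- The partial injection `(τ, n) ↦ (eτ, n + 1)`, defined if `r(e) = s(τ)`. -/
def edgePerm (e : E.Edge) : (E.EssAperiodicTrail × ℤ) ≃. (E.EssAperiodicTrail × ℤ) where
  toFun y := if h : E.rng e = y.1.1.source then some (cons e y.1 h, y.2 + 1) else none
  invFun z := if h : ∃ τ h, z.1 = cons e τ h then some (h.choose, z.2 - 1) else none
  inv := by
    rintro ⟨τ, n⟩ ⟨σ, m⟩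
    constructor
    · intro H
      split_ifs at H with h
      obtain ⟨rfl, rfl⟩ := Prod.mk.inj (Option.some.inj H)
      obtain ⟨h', h1⟩ := h.choose_spec
      rw [dif_pos h']
      simp only [Option.some.injEq, Prod.mk.injEq, sub_add_cancel, and_true]
      exact h1.symm
    · intro H
      split_ifs at H with h
      obtain ⟨rfl, rfl⟩ := Prod.mk.inj (Option.some.inj H)
      have hex : ∃ τ' h', cons e τ h = cons e τ' h' := ⟨τ, h, rfl⟩
      rw [dif_pos hex]
      obtain ⟨h', h1⟩ := hex.choose_spec
      simp only [Option.some.injEq, Prod.mk.injEq, add_sub_cancel_right, and_true]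
      exact (cons_inj h1).2.symm

theorem mem_edgePerm {e : E.Edge} {y z : E.EssAperiodicTrail × ℤ} :
    z ∈ edgePerm e y ↔ ∃ h : E.rng e = y.1.1.source, z = (cons e y.1 h, y.2 + 1) := by
  classical
  change (if h : E.rng e = y.1.1.source then some (cons e y.1 h, y.2 + 1) else none) = some z ↔ _
  split_ifs with h
  · simp [h, eq_comm]
  · simp [h]

/-- The partial injection `(τ, n) ↦ (lτ, n + |l|)`, for a walk `l` that starts at the given
vertex. -/
def walkPerm : E.Vert → List E.Edge → (E.EssAperiodicTrail × ℤ) ≃. (E.EssAperiodicTrail × ℤ)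
  | x, [] => vertPerm x
  | _, e :: l => (walkPerm (E.rng e) l).trans (edgePerm e)

theorem mem_walkPerm {x : E.Vert} {l : List E.Edge} (hl : E.IsWalk x l)
    {y z : E.EssAperiodicTrail × ℤ} :
    z ∈ walkPerm x l y ↔ IsConcat l y.1 z.1 ∧ z.1.1.source = x ∧ z.2 = y.2 + l.length := by
  induction l generalizing x z with
  | nil =>
    obtain ⟨τ, n⟩ := y
    obtain ⟨σ, m⟩ := z
    rw [walkPerm, mem_vertPerm]
    simp only [Prod.mk.injEq, IsConcat, List.length_nil, Nat.cast_zero, add_zero]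
    constructor
    · rintro ⟨⟨rfl, rfl⟩, h⟩
      exact ⟨rfl, h, rfl⟩
    · rintro ⟨rfl, h, rfl⟩
      exact ⟨⟨rfl, rfl⟩, h⟩
  | cons e l ih =>
    obtain ⟨rfl, hl⟩ := hl
    rw [walkPerm, PEquiv.mem_trans]
    constructor
    · rintro ⟨⟨ρ, k⟩, h1, h2⟩
      obtain ⟨h3, h4, h5⟩ := (ih hl).1 h1
      obtain ⟨h6, rfl⟩ := mem_edgePerm.1 h2
      refine ⟨⟨ρ, h6, h3, rfl⟩, source_cons _ _ _, ?_⟩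
      simp only [List.length_cons] at h5 ⊢
      push_cast
      omega
    · rintro ⟨⟨ρ, h, h1, h2⟩, -, h4⟩
      refine ⟨(ρ, y.2 + l.length), (ih hl).2 ⟨h1, h.symm, rfl⟩, mem_edgePerm.2 ⟨h, ?_⟩⟩
      refine Prod.ext h2 ?_
      simp only [List.length_cons] at h4 ⊢
      push_cast at h4
      omega

variable (R : Type u) [CommRing R]

theorem partialPerm_vertPerm_mem (x : E.Vert) :
    partialPerm (vertPerm x) ∈ homogeneousEnd R E 0 :=
  partialPerm_mem_homogeneousEnd fun y z h => by rw [(mem_vertPerm.1 h).1, add_zero]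

theorem partialPerm_edgePerm_mem (e : E.Edge) :
    partialPerm (edgePerm e) ∈ homogeneousEnd R E 1 :=
  partialPerm_mem_homogeneousEnd fun y z h => by
    obtain ⟨_, rfl⟩ := mem_edgePerm.1 h
    rfl

/-- The operators `S_v` and `S_e`. -/
def trailSystem : E.Vert ⊕ E.Edge → gradedEnd R E
  | .inl x => ⟨partialPerm (vertPerm x),
      mem_gradedEnd_of_homogeneous (partialPerm_vertPerm_mem R x)⟩
  | .inr e => ⟨partialPerm (edgePerm e),
      mem_gradedEnd_of_homogeneous (partialPerm_edgePerm_mem R e)⟩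

theorem coe_star_trailSystem_edge (e : E.Edge) :
    ((star (trailSystem R (.inr e)) : gradedEnd R E) : Module.End R (TrailModule R E)) =
      partialPerm (edgePerm e).symm :=
  (isTranspose_transpose _).unique isTranspose_partialPerm

variable {R} in
theorem partialPerm_congr {p q : (E.EssAperiodicTrail × ℤ) ≃. (E.EssAperiodicTrail × ℤ)}
    (h : ∀ y z, z ∈ p y ↔ z ∈ q y) : partialPerm (R := R) p = partialPerm q :=
  congrArg _ (PEquiv.ext fun y => Option.ext fun z => h y z)

/-- The multiplicative relations are checked on graphs of partial injections. Only the sum at a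
regular vertex needs matrix entries. -/
theorem trailSystem_isCuntzKriegerSystem :
    IsCuntzKriegerSystem E (trailSystem R : E.Vert ⊕ E.Edge → gradedEnd R E) where
  vert_mul_self x := Subtype.ext <| partialPerm_trans.symm.trans <| partialPerm_congr
    fun y z => by
      simp only [PEquiv.mem_trans, mem_vertPerm]
      constructor
      · rintro ⟨_, ⟨rfl, h⟩, rfl, -⟩
        exact ⟨rfl, h⟩
      · rintro ⟨rfl, h⟩
        exact ⟨_, ⟨rfl, h⟩, rfl, h⟩
  vert_mul_ne x x' hx := Subtype.ext <| partialPerm_trans.symm.trans <| partialPerm_eq_zero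
    fun y z => by
      simp only [PEquiv.mem_trans, mem_vertPerm]
      rintro ⟨_, ⟨rfl, h⟩, rfl, h'⟩
      exact hx (h'.symm.trans h)
  star_vert x := star_eq_of_isTranspose <| by
    have h := isTranspose_partialPerm (R := R) (p := vertPerm x)
    rwa [vertPerm, PEquiv.ofSet_symm] at h
  src_mul_edge e := Subtype.ext <| partialPerm_trans.symm.trans <| partialPerm_congr
    fun y z => by
      simp only [PEquiv.mem_trans, mem_vertPerm, mem_edgePerm]
      constructor
      · rintro ⟨_, h, rfl, -⟩
        exact h
      · rintro ⟨h, rfl⟩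
        exact ⟨_, ⟨h, rfl⟩, rfl, source_cons _ _ _⟩
  edge_mul_rng e := Subtype.ext <| partialPerm_trans.symm.trans <| partialPerm_congr
    fun y z => by
      simp only [PEquiv.mem_trans, mem_vertPerm, mem_edgePerm]
      constructor
      · rintro ⟨_, ⟨rfl, -⟩, h⟩
        exact h
      · rintro ⟨h, rfl⟩
        exact ⟨_, ⟨rfl, h.symm⟩, h, rfl⟩
  star_mul_edge e := Subtype.ext <|
    (congrArg (· * partialPerm (edgePerm e)) (coe_star_trailSystem_edge R e)).trans <|
    partialPerm_trans.symm.trans <| partialPerm_congr fun y z => by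
      simp only [PEquiv.mem_trans, PEquiv.mem_iff_mem, mem_vertPerm, mem_edgePerm]
      constructor
      · rintro ⟨_, ⟨h, rfl⟩, h', H⟩
        obtain ⟨h1, h2⟩ := Prod.mk.inj H
        exact ⟨Prod.ext (cons_inj h1).2.symm (by omega), h.symm⟩
      · rintro ⟨rfl, h⟩
        exact ⟨_, ⟨h.symm, rfl⟩, h.symm, rfl⟩
  star_mul_edge_ne e f hef := Subtype.ext <|
    (congrArg (· * partialPerm (edgePerm f)) (coe_star_trailSystem_edge R e)).trans <|
    partialPerm_trans.symm.trans <| partialPerm_eq_zero fun y z => by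
      simp only [PEquiv.mem_trans, PEquiv.mem_iff_mem, mem_edgePerm]
      rintro ⟨_, ⟨h, rfl⟩, h', H⟩
      exact hef (cons_inj (Prod.mk.inj H).1).1.symm
  vert_eq_sum x hx := Subtype.ext <| by
    have hcoe : ∀ e, ((trailSystem R (.inr e) * star (trailSystem R (.inr e)) : gradedEnd R E) :
        Module.End R (TrailModule R E)) = partialPerm ((edgePerm e).symm.trans (edgePerm e)) :=
      fun e => (congrArg (partialPerm (edgePerm e) * ·) (coe_star_trailSystem_edge R e)).trans
        partialPerm_trans.symm
    -- S_eS_e* is the projection onto the trails that begin with e.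
    have hmem : ∀ (e : E.Edge) (y z : E.EssAperiodicTrail × ℤ), z ∈ (edgePerm e).symm.trans (edgePerm e) y ↔
        z = y ∧ ∃ τ h, y.1 = cons e τ h := by
      rintro e ⟨σ, n⟩ z
      simp only [PEquiv.mem_trans, PEquiv.mem_iff_mem, mem_edgePerm]
      constructor
      · rintro ⟨⟨τ, m⟩, ⟨h, H⟩, h', rfl⟩
        exact ⟨H.symm, τ, h, (Prod.mk.inj H).1⟩
      · rintro ⟨rfl, τ, h, rfl⟩
        exact ⟨(τ, n - 1), ⟨h, by simp⟩, h, by simp⟩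
    rw [AddSubmonoidClass.coe_finsetSum]
    simp only [hcoe]
    refine end_ext fun y z => ?_
    rw [entry_sum]
    change entry (partialPerm (vertPerm x)) y z = _
    -- On the diagonal at x exactly one summand is 1, the one for the first edge of the trail; at
    -- all other positions every summand vanishes.
    by_cases hyz : z = y ∧ y.1.1.source = x
    · obtain ⟨rfl, rfl⟩ := hyz
      have hs : ¬ E.IsSink z.1.1.source := Set.nonempty_iff_ne_empty.1 hx.2
      obtain ⟨e, τ, h, hz⟩ := exists_eq_cons z.1 hs
      have he : E.src e = z.1.1.source := by rw [hz]; exact (source_cons e τ h).symm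
      rw [entry_partialPerm_of_mem (mem_vertPerm.2 ⟨rfl, rfl⟩),
        Finset.sum_eq_single_of_mem e (by simpa using he),
        entry_partialPerm_of_mem ((hmem e z z).2 ⟨rfl, τ, h, hz⟩)]
      intro f _ hfe
      refine entry_partialPerm_of_notMem fun H => ?_
      obtain ⟨-, τ', h', hz'⟩ := (hmem f z z).1 H
      exact hfe (cons_inj (hz'.symm.trans hz)).1
    · rw [entry_partialPerm_of_notMem (mt mem_vertPerm.1 hyz)]
      refine (Finset.sum_eq_zero fun e he => entry_partialPerm_of_notMem fun H => hyz ?_).symm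
      obtain ⟨rfl, τ, h, hz⟩ := (hmem e y z).1 H
      refine ⟨rfl, ?_⟩
      rw [hz, source_cons]
      simpa using he

theorem coe_extend_trailSystem (α : E.Path) :
    ((extend (trailSystem R) α : gradedEnd R E) : Module.End R (TrailModule R E)) =
      partialPerm (walkPerm α.source α.edges) := by
  obtain ⟨x, l, hl⟩ := α
  change ((extendWalk (trailSystem R) x l : gradedEnd R E) : Module.End R (TrailModule R E)) =
    partialPerm (walkPerm x l)
  induction l generalizing x with
  | nil => rfl
  | cons e l ih =>
    exact (congrArg (partialPerm (edgePerm e) * ·) (ih _ hl.2)).trans partialPerm_trans.symm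

theorem extend_trailSystem_mem (α : E.Path) :
    extend (trailSystem R) α ∈ grading R E α.length := by
  rw [mem_grading, coe_extend_trailSystem]
  exact partialPerm_mem_homogeneousEnd fun y z h => ((mem_walkPerm α.isWalk).1 h).2.2

theorem trailSystem_actsByConcatenation : ActsByConcatenation fun α : E.Path =>
    ((extend (trailSystem R) α : gradedEnd R E) : Module.End R (TrailModule R E)) := by
  intro α τ n
  simp only [coe_extend_trailSystem]
  constructor
  · intro h
    obtain ⟨h1, h2⟩ := (isConcat_iff α.isWalk).2 ⟨h, rfl⟩
    exact partialPerm_of_mem ((mem_walkPerm α.isWalk).2 ⟨h1, h2, add_comm _ _⟩)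
  · intro h
    refine partialPerm_of_forall_notMem fun z hz => ?_
    obtain ⟨h1, h2, -⟩ := (mem_walkPerm α.isWalk).1 hz
    exact h ((isConcat_iff α.isWalk).1 ⟨h1, h2⟩).1

end Operators

/-! ### Uniqueness of the system -/

/-- A Cuntz–Krieger system is determined by its extension to paths. -/
theorem IsCuntzKriegerSystem.ext_of_extend {E : Graph.{v, w}} {A : Type*} [NonUnitalRing A]
    [StarRing A] {S S' : E.Vert ⊕ E.Edge → A} (hS : IsCuntzKriegerSystem E S)
    (hS' : IsCuntzKriegerSystem E S') (h : ∀ α, extend S α = extend S' α) : S = S' := by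
  funext μ
  cases μ with
  | inl x => exact h ⟨x, [], trivial⟩
  | inr e =>
    rw [← hS.edge_mul_rng, ← hS'.edge_mul_rng]
    exact h (Graph.edgePath e)

theorem ActsByConcatenation.unique {R : Type u} [CommRing R] {E : Graph.{v, w}}
    {T T' : E.Path → Module.End R (TrailModule R E)} (h : ActsByConcatenation T)
    (h' : ActsByConcatenation T') : T = T' := by
  funext α
  refine (TrailModule.basis R E).ext fun ⟨τ, n⟩ => ?_
  by_cases hα : α.range = τ.1.source
  · exact ((h α τ n).1 hα).trans ((h' α τ n).1 hα).symm
  · exact ((h α τ n).2 hα).trans ((h' α τ n).2 hα).symm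

theorem Graph.isWalk_append_iff {E : Graph.{v, w}} {x : E.Vert} {l m : List E.Edge} :
    E.IsWalk x (l ++ m) ↔ E.IsWalk x l ∧ E.IsWalk (E.walkEnd x l) m := by
  induction l generalizing x with
  | nil => exact ⟨fun h => ⟨trivial, h⟩, fun h => h.2⟩
  | cons e l ih =>
    exact ⟨fun h => ⟨⟨h.1, (ih.1 h.2).1⟩, (ih.1 h.2).2⟩, fun h => ⟨h.1.1, ih.2 ⟨h.1.2, h.2⟩⟩⟩

/-! ### Products in a Cuntz–Krieger system -/

namespace IsCuntzKriegerSystem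

variable {E : Graph.{v, w}} {A : Type*} [NonUnitalRing A] [StarRing A]
  {S : E.Vert ⊕ E.Edge → A} (hS : IsCuntzKriegerSystem E S)

include hS

theorem vert_mul_extendWalk {x : E.Vert} {l : List E.Edge} (hl : E.IsWalk x l) :
    S (.inl x) * extendWalk S x l = extendWalk S x l := by
  cases l with
  | nil => exact hS.vert_mul_self x
  | cons e l =>
    obtain ⟨rfl, hl⟩ := hl
    rw [extendWalk, ← mul_assoc, hS.src_mul_edge]

theorem vert_mul_extendWalk_of_ne {x y : E.Vert} {l : List E.Edge} (hl : E.IsWalk x l)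
    (h : y ≠ x) : S (.inl y) * extendWalk S x l = 0 := by
  rw [← hS.vert_mul_extendWalk hl, ← mul_assoc, hS.vert_mul_ne y x h, zero_mul]

theorem extendWalk_mul_vert {x : E.Vert} {l : List E.Edge} :
    extendWalk S x l * S (.inl (E.walkEnd x l)) = extendWalk S x l := by
  induction l generalizing x with
  | nil => exact hS.vert_mul_self x
  | cons e l ih => rw [extendWalk, mul_assoc]; exact congrArg _ ih

theorem edge_mul_extendWalk_of_ne {e : E.Edge} {x : E.Vert} {l : List E.Edge}
    (hl : E.IsWalk x l) (h : E.rng e ≠ x) : S (.inr e) * extendWalk S x l = 0 := by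
  rw [← hS.edge_mul_rng, mul_assoc, hS.vert_mul_extendWalk_of_ne hl h, mul_zero]

theorem star_edge_mul_src (e : E.Edge) :
    star (S (.inr e)) * S (.inl (E.src e)) = star (S (.inr e)) := by
  rw [← hS.star_vert, ← star_mul, hS.src_mul_edge]

theorem rng_mul_star_edge (e : E.Edge) :
    S (.inl (E.rng e)) * star (S (.inr e)) = star (S (.inr e)) := by
  rw [← hS.star_vert, ← star_mul, hS.edge_mul_rng]

theorem star_edge_mul_extendWalk_cons {e : E.Edge} {x : E.Vert} {l : List E.Edge}
    (hl : E.IsWalk x (e :: l)) :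
    star (S (.inr e)) * extendWalk S x (e :: l) = extendWalk S (E.rng e) l := by
  rw [extendWalk, ← mul_assoc, hS.star_mul_edge, hS.vert_mul_extendWalk hl.2]

theorem star_edge_mul_extendWalk_cons_of_ne {e f : E.Edge} (h : e ≠ f) (x : E.Vert)
    (l : List E.Edge) : star (S (.inr e)) * extendWalk S x (f :: l) = 0 := by
  rw [extendWalk, ← mul_assoc, hS.star_mul_edge_ne e f h, zero_mul]

/-- The idempotent that closes the shorter product sits at s(e) and is absorbed by S_e, which also
absorbs the one at r(e). -/
theorem extendWalk_append_singleton {x : E.Vert} {l : List E.Edge} {e : E.Edge}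
    (hl : E.IsWalk x (l ++ [e])) :
    extendWalk S x (l ++ [e]) = extendWalk S x l * S (.inr e) := by
  induction l generalizing x with
  | nil =>
    obtain ⟨rfl, -⟩ := hl
    exact (hS.edge_mul_rng e).trans (hS.src_mul_edge e).symm
  | cons f l ih =>
    rw [List.cons_append, extendWalk, ih hl.2, extendWalk, mul_assoc]

/-- The idempotent at the common end vertex is inserted between the factors and expanded as ∑ ff*,
which prolongs both paths by f. -/
theorem extendWalk_mul_star_eq_sum {x y : E.Vert} {l m : List E.Edge} (hl : E.IsWalk x l)
    (hm : E.IsWalk y m) (h : E.walkEnd x l = E.walkEnd y m)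
    (hreg : E.IsRegular (E.walkEnd x l)) :
    extendWalk S x l * star (extendWalk S y m) =
      ∑ f ∈ hreg.1.toFinset, extendWalk S x (l ++ [f]) * star (extendWalk S y (m ++ [f])) := by
  rw [← hS.extendWalk_mul_vert (x := x), hS.vert_eq_sum _ hreg, Finset.mul_sum, Finset.sum_mul]
  refine Finset.sum_congr rfl fun f hf => ?_
  have hf : E.src f = E.walkEnd x l := by simpa using hf
  rw [hS.extendWalk_append_singleton (Graph.isWalk_append hl ⟨hf, trivial⟩),
    hS.extendWalk_append_singleton (Graph.isWalk_append hm ⟨hf.trans h, trivial⟩), star_mul]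
  simp only [mul_assoc]

end IsCuntzKriegerSystem

/-! ### A spanning set of the Leavitt path algebra -/

section Span

variable (R : Type u) [CommRing R] (E : Graph.{v, w})

open LPA.Graph

/-- The generators `v` and `e` of `L_R(E)`. -/
def leavittSystem : E.Vert ⊕ E.Edge → LeavittPathAlgebra R E
  | .inl x => gen R E (.vert x)
  | .inr e => gen R E (.edge e)

theorem star_leavittSystem_edge (e : E.Edge) :
    star (leavittSystem R E (.inr e)) = gen R E (.ghost e) := star_gen R E (.edge e)

theorem leavittSystem_isCuntzKriegerSystem :
    IsCuntzKriegerSystem E (leavittSystem R E) where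
  vert_mul_self := (gen_relations R E).vert_mul_self
  vert_mul_ne := (gen_relations R E).vert_mul_ne
  star_vert x := star_gen R E (.vert x)
  src_mul_edge := (gen_relations R E).src_mul_edge
  edge_mul_rng := (gen_relations R E).edge_mul_rng
  star_mul_edge e := by
    rw [star_leavittSystem_edge]; exact (gen_relations R E).ghost_mul_edge e
  star_mul_edge_ne e f h := by
    rw [star_leavittSystem_edge]; exact (gen_relations R E).ghost_mul_edge_ne e f h
  vert_eq_sum x h := by
    simp only [star_leavittSystem_edge]; exact (gen_relations R E).vert_eq_sum x h

/-- The element `αβ*` of `L_R(E)`. -/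
def monomial (p : E.Path × E.Path) : LeavittPathAlgebra R E :=
  extend (leavittSystem R E) p.1 * star (extend (leavittSystem R E) p.2)

variable {E}

/-- The paths have the same range. -/
def IsComposable (p : E.Path × E.Path) : Prop := p.1.range = p.2.range

/-- The paths have the same range and do not both end in the same special edge. -/
def IsReduced (p : E.Path × E.Path) : Prop :=
  IsComposable p ∧
    ∀ e l m, p.1.edges = l ++ [e] → p.2.edges = m ++ [e] → ¬ IsSpecial e

variable {R}

theorem gen_mem_span (a : Gen E) :
    gen R E a ∈ Submodule.span R (monomial R E '' {p | IsComposable p}) := by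
  have hS := leavittSystem_isCuntzKriegerSystem R E
  refine Submodule.subset_span ?_
  cases a with
  | vert x =>
    refine ⟨(⟨x, [], trivial⟩, ⟨x, [], trivial⟩), rfl, ?_⟩
    change leavittSystem R E (.inl x) * star (leavittSystem R E (.inl x)) = _
    rw [hS.star_vert, hS.vert_mul_self]
    rfl
  | edge e =>
    refine ⟨(edgePath e, ⟨E.rng e, [], trivial⟩), rfl, ?_⟩
    change leavittSystem R E (.inr e) * leavittSystem R E (.inl (E.rng e)) *
      star (leavittSystem R E (.inl (E.rng e))) = _
    rw [hS.star_vert, hS.edge_mul_rng, hS.edge_mul_rng]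
    rfl
  | ghost e =>
    refine ⟨(⟨E.rng e, [], trivial⟩, edgePath e), rfl, ?_⟩
    change leavittSystem R E (.inl (E.rng e)) *
      star (leavittSystem R E (.inr e) * leavittSystem R E (.inl (E.rng e))) = _
    rw [hS.edge_mul_rng, hS.rng_mul_star_edge]
    exact star_leavittSystem_edge R E e

theorem gen_mul_monomial_mem_span (a : Gen E) {p : E.Path × E.Path} (hp : IsComposable p) :
    gen R E a * monomial R E p ∈ Submodule.span R (monomial R E '' {p | IsComposable p}) := by
  have hS := leavittSystem_isCuntzKriegerSystem R E
  obtain ⟨⟨x, l, hl⟩, ⟨y, m, hm⟩⟩ := p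
  change E.walkEnd x l = E.walkEnd y m at hp
  change gen R E a * (extendWalk (leavittSystem R E) x l *
    star (extendWalk (leavittSystem R E) y m)) ∈ _
  rw [← mul_assoc]
  cases a with
  | vert z =>
    change leavittSystem R E (.inl z) * _ * _ ∈ _
    by_cases hz : z = x
    · subst hz
      rw [hS.vert_mul_extendWalk hl]
      exact Submodule.subset_span ⟨(⟨z, l, hl⟩, ⟨y, m, hm⟩), hp, rfl⟩
    · rw [hS.vert_mul_extendWalk_of_ne hl hz, zero_mul]
      exact zero_mem _
  | edge e =>
    change leavittSystem R E (.inr e) * _ * _ ∈ _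
    by_cases he : E.rng e = x
    · subst he
      exact Submodule.subset_span ⟨(⟨E.src e, e :: l, rfl, hl⟩, ⟨y, m, hm⟩), hp, rfl⟩
    · rw [hS.edge_mul_extendWalk_of_ne hl he, zero_mul]
      exact zero_mem _
  | ghost e =>
    rw [← star_leavittSystem_edge]
    cases l with
    | nil =>
      change E.walkEnd x [] = _ at hp
      by_cases he : E.src e = x
      · subst he
        -- A ghost edge that meets a path of length 0 moves to the right-hand path: e*β* = (βe)*.
        have hm' : E.IsWalk y (m ++ [e]) := isWalk_append hm ⟨hp, trivial⟩
        refine Submodule.subset_span ⟨(⟨E.rng e, [], trivial⟩, ⟨y, m ++ [e], hm'⟩), ?_, ?_⟩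
        · exact (walkEnd_append y m [e]).symm
        · change leavittSystem R E (.inl (E.rng e)) *
            star (extendWalk (leavittSystem R E) y (m ++ [e])) = _
          rw [hS.extendWalk_append_singleton hm', star_mul, ← mul_assoc, hS.rng_mul_star_edge]
          change _ = star (leavittSystem R E (.inr e)) * leavittSystem R E (.inl (E.src e)) * _
          rw [hS.star_edge_mul_src]
      · change star (leavittSystem R E (.inr e)) * leavittSystem R E (.inl x) * _ ∈ _
        rw [← hS.star_edge_mul_src, mul_assoc (star _), hS.vert_mul_ne _ _ he, mul_zero,
          zero_mul]
        exact zero_mem _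
    | cons f l =>
      by_cases he : e = f
      · subst he
        rw [hS.star_edge_mul_extendWalk_cons hl]
        exact Submodule.subset_span ⟨(⟨E.rng e, l, hl.2⟩, ⟨y, m, hm⟩), hp, rfl⟩
      · rw [hS.star_edge_mul_extendWalk_cons_of_ne he, zero_mul]
        exact zero_mem _

theorem gen_mul_mem_span (a : Gen E) {x : LeavittPathAlgebra R E}
    (hx : x ∈ Submodule.span R (monomial R E '' {p | IsComposable p})) :
    gen R E a * x ∈ Submodule.span R (monomial R E '' {p | IsComposable p}) := by
  induction hx using Submodule.span_induction with
  | mem x hx =>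
    obtain ⟨p, hp, rfl⟩ := hx
    exact gen_mul_monomial_mem_span a hp
  | zero => rw [mul_zero]; exact zero_mem _
  | add x y _ _ hx hy => rw [mul_add]; exact add_mem hx hy
  | smul r x _ hx => rw [mul_smul_comm]; exact Submodule.smul_mem _ r hx

theorem mem_span_monomial (x : LeavittPathAlgebra R E) :
    x ∈ Submodule.span R (monomial R E '' {p | IsComposable p}) := by
  set V := Submodule.span R (monomial R E '' {p | IsComposable p}) with hV
  -- Membership alone does not pass to products; stability of `V` under left multiplication makes
  -- the induction close.
  suffices h : x ∈ V ∧ ∀ y ∈ V, x * y ∈ V from h.1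
  obtain ⟨x, hx⟩ := x
  induction hx using NonUnitalAlgebra.adjoin_induction with
  | mem x hx =>
    obtain ⟨a, rfl⟩ := hx
    exact ⟨gen_mem_span a, fun y hy => gen_mul_mem_span a hy⟩
  | add x y hx' hy' hx hy =>
    have h : (⟨x + y, add_mem hx' hy'⟩ : LeavittPathAlgebra R E) = ⟨x, hx'⟩ + ⟨y, hy'⟩ := rfl
    rw [h]
    exact ⟨add_mem hx.1 hy.1, fun z hz => by
      rw [add_mul]; exact add_mem (hx.2 z hz) (hy.2 z hz)⟩
  | zero =>
    have h : (⟨0, zero_mem _⟩ : LeavittPathAlgebra R E) = 0 := rfl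
    rw [h]
    exact ⟨zero_mem _, fun z _ => by rw [zero_mul]; exact zero_mem _⟩
  | mul x y hx' hy' hx hy =>
    have h : (⟨x * y, mul_mem hx' hy'⟩ : LeavittPathAlgebra R E) = ⟨x, hx'⟩ * ⟨y, hy'⟩ := rfl
    rw [h]
    exact ⟨hx.2 _ hy.1, fun z hz => by rw [mul_assoc]; exact hx.2 _ (hy.2 z hz)⟩
  | smul r x hx' hx =>
    have h : (⟨r • x, SMulMemClass.smul_mem r hx'⟩ : LeavittPathAlgebra R E) = r • ⟨x, hx'⟩ :=
      rfl
    rw [h]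
    exact ⟨Submodule.smul_mem _ r hx.1, fun z hz => by
      rw [smul_mul_assoc]; exact Submodule.smul_mem _ r (hx.2 z hz)⟩

theorem mem_of_add_mem {V : Submodule R (LeavittPathAlgebra R E)} {a b : LeavittPathAlgebra R E}
    (ha : a + b ∈ V) (hb : b ∈ V) : a ∈ V := by
  have h : a = (a + b) + (-1 : R) • b := by
    rw [neg_one_smul R b]
    exact (add_neg_cancel_right a b).symm
  rw [h]
  exact V.add_mem ha (V.smul_mem _ hb)

/-- Induction on |α|. If α = λe and β = μe with e special, the relation at s(e) gives αβ* = λμ* - ∑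
λf(μf)* over f ≠ e. The first term is shorter, and the others are already reduced since s(e) has
only one special edge. -/
theorem monomial_mem_span_reduced {p : E.Path × E.Path} (hp : IsComposable p) :
    monomial R E p ∈ Submodule.span R (monomial R E '' {p | IsReduced p}) := by
  classical
  have hS := leavittSystem_isCuntzKriegerSystem R E
  obtain ⟨n, hn⟩ : ∃ n, p.1.edges.length = n := ⟨_, rfl⟩
  induction n generalizing p with
  | zero =>
    refine Submodule.subset_span ⟨p, ⟨hp, fun e l m h => ?_⟩, rfl⟩
    rw [h] at hn
    simp at hn
  | succ n ih =>
    by_cases hred : IsReduced p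
    · exact Submodule.subset_span ⟨p, hred, rfl⟩
    obtain ⟨e, l, m, h1, h2, he⟩ : ∃ e l m, p.1.edges = l ++ [e] ∧ p.2.edges = m ++ [e] ∧
        IsSpecial e := by
      by_contra! h
      exact hred ⟨hp, h⟩
    obtain ⟨⟨x, l', hl⟩, ⟨y, m', hm⟩⟩ := p
    change l' = l ++ [e] at h1
    change m' = m ++ [e] at h2
    subst h1 h2
    obtain ⟨hl', hle, -⟩ := isWalk_append_iff.1 hl
    obtain ⟨hm', hme, -⟩ := isWalk_append_iff.1 hm
    have hreg : E.IsRegular (E.walkEnd x l) := hle ▸ he.1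
    have hlm : E.walkEnd x l = E.walkEnd y m := hle.symm.trans hme
    have hsum := hS.extendWalk_mul_star_eq_sum hl' hm' hlm hreg
    rw [← Finset.add_sum_erase _ _ (a := e) (by simpa using hle)] at hsum
    have hlow : extendWalk (leavittSystem R E) x l * star (extendWalk (leavittSystem R E) y m) ∈
        Submodule.span R (monomial R E '' {p | IsReduced p}) :=
      ih (p := (⟨x, l, hl'⟩, ⟨y, m, hm'⟩)) hlm (by simpa using hn)
    refine mem_of_add_mem (hsum ▸ hlow) (sum_mem fun f hf => ?_)
    rw [Finset.mem_erase] at hf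
    have hfe : E.src f = E.src e := by simpa [hle] using hf.2
    have hlf : E.IsWalk x (l ++ [f]) := isWalk_append hl' ⟨hfe.trans hle, trivial⟩
    have hmf : E.IsWalk y (m ++ [f]) := isWalk_append hm' ⟨hfe.trans hme, trivial⟩
    refine Submodule.subset_span ⟨(⟨x, l ++ [f], hlf⟩, ⟨y, m ++ [f], hmf⟩), ⟨?_, ?_⟩, ?_⟩
    · exact (walkEnd_append x l [f]).trans (walkEnd_append y m [f]).symm
    · intro e' l₁ m₁ h _ hsp
      obtain ⟨-, h⟩ := List.append_inj' (h : l ++ [f] = l₁ ++ [e']) rfl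
      obtain rfl : f = e' := by simpa using h
      exact hf.1 (hsp.eq he hfe)
    · rfl

variable (R E) in
/-- `L_R(E)` is spanned by the reduced monomials. -/
theorem span_reduced_eq_top :
    Submodule.span R (monomial R E '' {p | IsReduced p}) = ⊤ := by
  rw [eq_top_iff]
  intro x _
  refine Submodule.span_le.2 ?_ (mem_span_monomial x)
  rintro _ ⟨p, hp, rfl⟩
  exact monomial_mem_span_reduced hp

end Span

/-! ### The homomorphism associated with a Cuntz–Krieger system -/

section Associated

variable {R : Type u} [CommRing R] {E : Graph.{v, w}} {A : Type*} [NonUnitalRing A] [StarRing A]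
  [Module R A] {S : E.Vert ⊕ E.Edge → A}

theorem leavitt_star_smul (r : R) (x : LeavittPathAlgebra R E) : star (r • x) = r • star x :=
  Subtype.ext (congrArg MulOpposite.unop (map_smul (starHom R E) r x.1))

/-- The images of the generators under the homomorphism associated with `S`. -/
def associatedGen (S : E.Vert ⊕ E.Edge → A) : Gen E → A
  | .vert x => S (.inl x)
  | .edge e => S (.inr e)
  | .ghost e => star (S (.inr e))

theorem IsCuntzKriegerSystem.leavittRelations (hS : IsCuntzKriegerSystem E S) :
    LeavittRelations E (associatedGen S) where
  vert_mul_self := hS.vert_mul_self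
  vert_mul_ne := hS.vert_mul_ne
  src_mul_edge := hS.src_mul_edge
  edge_mul_rng := hS.edge_mul_rng
  rng_mul_ghost := hS.rng_mul_star_edge
  ghost_mul_src := hS.star_edge_mul_src
  ghost_mul_edge := hS.star_mul_edge
  ghost_mul_edge_ne := hS.star_mul_edge_ne
  vert_eq_sum := hS.vert_eq_sum

variable [IsScalarTower R A A] [SMulCommClass R A A]

theorem IsCuntzKriegerSystem.exists_isAssociated (hS : IsCuntzKriegerSystem E S)
    (hA : ∀ (r : R) (a : A), star (r • a) = r • star a) :
    ∃ φ : LeavittPathAlgebra R E →⋆ₙₐ[R] A, IsAssociated S φ := by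
  obtain ⟨φ, hφ, huniq⟩ := exists_unique_lift R E _ hS.leavittRelations
  -- Conjugating φ by the two involutions gives a homomorphism with the same values on generators.
  -- By uniqueness it equals φ, so φ preserves the involution.
  let ψ : LeavittPathAlgebra R E →ₙₐ[R] A :=
    { toFun := fun x => star (φ (star x))
      map_smul' := fun r x => by
        rw [leavitt_star_smul, map_smul, hA]; rfl
      map_zero' := by rw [star_zero, map_zero, star_zero]
      map_add' := fun x y => by rw [star_add, map_add, star_add]
      map_mul' := fun x y => by rw [star_mul, map_mul, star_mul] }
  have hψ : ψ = φ := huniq ψ fun a => by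
    change star (φ (star (gen R E a))) = _
    rw [star_gen, hφ]
    cases a with
    | vert x => exact hS.star_vert x
    | edge e => exact star_star _
    | ghost e => rfl
  refine ⟨{ φ with map_star' := fun x => ?_ },
    ⟨fun x => hφ (.vert x), fun e => hφ (.edge e), fun e => hφ (.ghost e)⟩⟩
  have h : star (φ (star (star x))) = φ (star x) := DFunLike.congr_fun hψ (star x)
  rw [star_star] at h
  exact h.symm

theorem IsAssociated.unique (hS : IsCuntzKriegerSystem E S)
    {φ ψ : LeavittPathAlgebra R E →⋆ₙₐ[R] A} (hφ : IsAssociated S φ) (hψ : IsAssociated S ψ) :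
    φ = ψ := by
  obtain ⟨χ, -, huniq⟩ := exists_unique_lift R E _ hS.leavittRelations
  have key : ∀ ρ : LeavittPathAlgebra R E →⋆ₙₐ[R] A, IsAssociated S ρ →
      ρ.toNonUnitalAlgHom = χ := fun ρ hρ => huniq _ fun a => by
    cases a with
    | vert x => exact hρ.vert x
    | edge e => exact hρ.edge e
    | ghost e => exact hρ.ghost e
  exact DFunLike.ext _ _ fun x => DFunLike.congr_fun ((key φ hφ).trans (key ψ hψ).symm) x

omit [IsScalarTower R A A] [SMulCommClass R A A] in
theorem IsAssociated.map_extend {φ : LeavittPathAlgebra R E →⋆ₙₐ[R] A} (hφ : IsAssociated S φ)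
    (α : E.Path) : φ (extend (leavittSystem R E) α) = extend S α := by
  obtain ⟨x, l, hl⟩ := α
  change φ (extendWalk (leavittSystem R E) x l) = extendWalk S x l
  induction l generalizing x with
  | nil => exact hφ.vert x
  | cons e l ih =>
    rw [extendWalk, extendWalk, map_mul, ih _ hl.2]
    exact congrArg (· * _) (hφ.edge e)

end Associated

/-! ### Injectivity -/

section Injective

variable {R : Type u} [CommRing R] {E : Graph.{v, w}}

open LPA.Graph LPA.Graph.EssAperiodicTrail

/-- The partial injection `βρ ↦ αρ`. -/
def monomialPerm (p : E.Path × E.Path) :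
    (E.EssAperiodicTrail × ℤ) ≃. (E.EssAperiodicTrail × ℤ) :=
  (walkPerm p.2.source p.2.edges).symm.trans (walkPerm p.1.source p.1.edges)

theorem mem_monomialPerm {p : E.Path × E.Path} {y z : E.EssAperiodicTrail × ℤ} :
    z ∈ monomialPerm p y ↔ ∃ u : E.EssAperiodicTrail × ℤ,
      (IsConcat p.2.edges u.1 y.1 ∧ y.1.1.source = p.2.source ∧ y.2 = u.2 + p.2.length) ∧
      (IsConcat p.1.edges u.1 z.1 ∧ z.1.1.source = p.1.source ∧ z.2 = u.2 + p.1.length) := by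
  rw [monomialPerm, PEquiv.mem_trans]
  simp only [PEquiv.mem_iff_mem, mem_walkPerm p.1.isWalk, mem_walkPerm p.2.isWalk]
  rfl

theorem coe_map_monomial {φ : LeavittPathAlgebra R E →⋆ₙₐ[R] gradedEnd R E}
    (hφ : IsAssociated (trailSystem R) φ) (p : E.Path × E.Path) :
    (φ (monomial R E p) : Module.End R (TrailModule R E)) = partialPerm (monomialPerm p) := by
  rw [monomial, map_mul, map_star, hφ.map_extend, hφ.map_extend, monomialPerm, partialPerm_trans]
  have h : ((star (extend (trailSystem R) p.2) : gradedEnd R E) :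
      Module.End R (TrailModule R E)) = partialPerm (walkPerm p.2.source p.2.edges).symm := by
    refine (isTranspose_transpose _).unique ?_
    rw [coe_extend_trailSystem]
    exact isTranspose_partialPerm
  exact congrArg₂ (· * ·) (coe_extend_trailSystem R p.1) h

/-- For a generic trail `τ`, a reduced monomial `αβ*` that is not shorter than `α₀β₀*` and maps
`β₀τ` to `α₀τ` is equal to `α₀β₀*`. -/
theorem eq_of_mem_monomialPerm {p₀ p : E.Path × E.Path} (hp : IsReduced p)
    (hlen : p₀.1.length + p₀.2.length ≤ p.1.length + p.2.length)
    {τ : E.EssAperiodicTrail}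
    (hτ : ∀ l e τ', IsConcat (l ++ [e]) τ' τ → l.length < p.1.length →
      (∀ a ∈ l ++ [e], a ∈ p.1.edges) → IsSpecial e)
    (h₁ : p₀.1.range = τ.1.source) (h₂ : p₀.2.range = τ.1.source)
    (h : (concat p₀.1 τ h₁, (p₀.1.length : ℤ)) ∈
      monomialPerm p (concat p₀.2 τ h₂, (p₀.2.length : ℤ))) : p = p₀ := by
  obtain ⟨⟨ρ, n⟩, ⟨hβ, hβs, hβn⟩, ⟨hα, hαs, hαn⟩⟩ := mem_monomialPerm.1 h
  simp only at hβn hαn hβ hα hβs hαs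
  have h3 : IsConcat p₀.1.edges τ (concat p₀.1 τ h₁) :=
    ((isConcat_iff p₀.1.isWalk).2 ⟨h₁, rfl⟩).1
  have h4 : IsConcat p₀.2.edges τ (concat p₀.2 τ h₂) :=
    ((isConcat_iff p₀.2.isWalk).2 ⟨h₂, rfl⟩).1
  rw [source_concat] at hβs hαs
  -- Both |p₀.1| - |p.1| and |p₀.2| - |p.2| equal the exponent n, so `hlen` gives n ≤ 0: both paths
  -- of p₀ are prefixes, and the two remainders have the same length -n.
  obtain ⟨m, hm, hmτ⟩ := isConcat_cancel h3 hα
    (show p₀.1.length ≤ p.1.length by omega)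
  obtain ⟨m', hm', hmτ'⟩ := isConcat_cancel h4 hβ
    (show p₀.2.length ≤ p.2.length by omega)
  have e1 : p.1.length = p₀.1.length + m.length := by
    rw [Path.length, hm, List.length_append]; rfl
  have e2 : p.2.length = p₀.2.length + m'.length := by
    rw [Path.length, hm', List.length_append]; rfl
  obtain ⟨k, rfl, -⟩ := isConcat_cancel hmτ hmτ' (by omega)
  obtain rfl : k = [] := by
    rw [List.length_append] at e2
    exact List.length_eq_zero_iff.1 (by omega)
  rw [List.append_nil] at hm'
  -- A nonempty common remainder is a prefix of τ with edges in p.1, so its last edge is special,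
  -- yet it ends both paths of the reduced pair p.
  rcases List.eq_nil_or_concat m with rfl | ⟨l, e, rfl⟩
  · rw [List.append_nil] at hm hm'
    exact Prod.ext (Graph.Path.ext hαs.symm hm) (Graph.Path.ext hβs.symm hm')
  · rw [List.concat_eq_append] at hm hm' hmτ e1
    refine absurd (hτ l e ρ hmτ ?_ fun a ha => ?_)
      (hp.2 e (p₀.1.edges ++ l) (p₀.2.edges ++ l) (by rw [hm, List.append_assoc])
        (by rw [hm', List.append_assoc]))
    · rw [e1, List.length_append, List.length_singleton]
      omega
    · rw [hm]
      exact List.mem_append_right _ ha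

theorem IsAssociated.injective {φ : LeavittPathAlgebra R E →⋆ₙₐ[R] gradedEnd R E}
    (hφ : IsAssociated (trailSystem R) φ) : Function.Injective φ := by
  rw [injective_iff_map_eq_zero]
  intro x hx
  have hmem : x ∈ Submodule.span R (monomial R E '' {p | IsReduced p}) := by
    rw [span_reduced_eq_top]; trivial
  obtain ⟨c, hc, rfl⟩ := (Finsupp.mem_span_image_iff_linearCombination R).1 hmem
  have hzero : ∀ y z, ∑ p ∈ c.support, c p * entry (partialPerm (monomialPerm p)) y z = 0 := by
    intro y z
    have h := congrArg (fun a : gradedEnd R E => entry a.1 y z) hx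
    rw [Finsupp.linearCombination_apply, Finsupp.sum, map_sum] at h
    simp only [map_smul] at h
    rw [AddSubmonoidClass.coe_finsetSum, entry_sum] at h
    refine (Finset.sum_congr rfl fun p _ => ?_).trans (h.trans (entry_zero y z))
    rw [← coe_map_monomial hφ]
    exact (entry_smul _ _ y z).symm
  by_contra hne
  have hsupp : c.support.Nonempty := by
    rw [Finsupp.support_nonempty_iff]
    rintro rfl
    exact hne (map_zero _)
  -- Minimality of total length supplies the comparison needed in `eq_of_mem_monomialPerm`. The
  -- trail is then chosen generic for all left-hand paths of the support at once.
  obtain ⟨p₀, hp₀, hmin⟩ := c.support.exists_min_image (fun p => p.1.length + p.2.length) hsupp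
  obtain ⟨τ, hτ, hgen⟩ := exists_generic_trail (c.support.sup fun p => p.1.length)
    (⋃ p ∈ c.support, {a | a ∈ p.1.edges})
    (c.support.finite_toSet.biUnion fun p _ => p.1.edges.finite_toSet) p₀.1.range
  have hred : IsReduced p₀ := hc hp₀
  have h₂ : p₀.2.range = τ.1.source := hred.1.symm.trans hτ.symm
  -- The matrix position that isolates the coefficient of p₀: its monomial has entry 1 there, all
  -- others in the support have entry 0.
  have h := hzero (concat p₀.2 τ h₂, (p₀.2.length : ℤ)) (concat p₀.1 τ hτ.symm, (p₀.1.length : ℤ))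
  rw [Finset.sum_eq_single_of_mem p₀ hp₀, entry_partialPerm_of_mem, mul_one] at h
  · exact Finsupp.mem_support_iff.1 hp₀ h
  · obtain ⟨h3, h4⟩ := (isConcat_iff p₀.1.isWalk).2 ⟨hτ.symm, rfl⟩
    obtain ⟨h5, h6⟩ := (isConcat_iff p₀.2.isWalk).2 ⟨h₂, rfl⟩
    exact mem_monomialPerm.2 ⟨(τ, 0), ⟨h5, h6, (zero_add _).symm⟩, h3, h4, (zero_add _).symm⟩
  · intro p hp hne
    rw [entry_partialPerm_of_notMem, mul_zero]
    refine fun H => hne (eq_of_mem_monomialPerm (hc hp) (hmin p hp) ?_ hτ.symm h₂ H)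
    intro l e τ' hl hlen ha
    refine hgen l e τ' hl (hlen.trans_le (Finset.le_sup (f := fun p => p.1.length) hp))
      fun a h => ?_
    exact Set.mem_biUnion (show p ∈ (c.support : Set _) from hp) (ha a h)

end Injective

end

end LPA

/-! ### The theorem -/

theorem mainTheorem4 {R : Type u} [CommRing R] (E : LPA.Graph.{v, w}) :
    ∃ (A : Subalgebra R (Module.End R (LPA.TrailModule R E))) (_ : StarRing A)
      (G : ℤ → Submodule R A),
      -- `A` is graded by the `G k`
      SetLike.GradedMonoid G ∧ DirectSum.IsInternal G ∧
      -- `G k` is the set of homogeneous endomorphisms of degree `k` which have a transpose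
      (∀ (k : ℤ) (f : Module.End R (LPA.TrailModule R E)),
        (∃ a ∈ G k, (a : Module.End R (LPA.TrailModule R E)) = f) ↔
          LPA.IsHomogeneous k f ∧ ∃ g, LPA.IsTranspose f g) ∧
      -- the involution is `R`-linear, and it is transposition
      (∀ (r : R) (a : A), star (r • a) = r • star a) ∧
      (∀ a : A, LPA.IsTranspose (a : Module.End R (LPA.TrailModule R E)) (star a : A)) ∧
      -- the Cuntz–Krieger system
      ∃ S : E.Vert ⊕ E.Edge → A,
        LPA.IsCuntzKriegerSystem E S ∧
        LPA.ActsByConcatenation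
          (fun α => ((LPA.extend S α : A) : Module.End R (LPA.TrailModule R E))) ∧
        (∀ S' : E.Vert ⊕ E.Edge → A, LPA.IsCuntzKriegerSystem E S' →
          LPA.ActsByConcatenation
            (fun α => ((LPA.extend S' α : A) : Module.End R (LPA.TrailModule R E))) → S' = S) ∧
        (∀ α : E.Path, LPA.extend S α ∈ G α.length) ∧
        -- the associated representation
        ∃ P : LPA.LeavittPathAlgebra R E →⋆ₙₐ[R] A,
          LPA.IsAssociated S P ∧
          (∀ P' : LPA.LeavittPathAlgebra R E →⋆ₙₐ[R] A, LPA.IsAssociated S P' → P' = P) ∧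
          Function.Injective P := by
  have hS := LPA.trailSystem_isCuntzKriegerSystem (E := E) R
  obtain ⟨P, hP⟩ := hS.exists_isAssociated LPA.gradedEnd_star_smul
  refine ⟨LPA.gradedEnd R E, LPA.gradedEndStarRing, LPA.grading R E, inferInstance,
    LPA.grading_isInternal R E, fun k f => ⟨?_, fun hf => ?_⟩, LPA.gradedEnd_star_smul,
    LPA.isTranspose_transpose, LPA.trailSystem R, hS, LPA.trailSystem_actsByConcatenation R,
    fun S' hS' hact => ?_, LPA.extend_trailSystem_mem R, P, hP,
    fun P' hP' => hP'.unique hS hP, hP.injective⟩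
  · rintro ⟨a, ha, rfl⟩
    exact ha
  · exact ⟨⟨f, LPA.mem_gradedEnd_of_homogeneous hf⟩, hf, rfl⟩
  · refine hS'.ext_of_extend hS fun α => Subtype.ext ?_
    exact congrFun (hact.unique (LPA.trailSystem_actsByConcatenation R)) α
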